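/- For $n\ge 2$, let $\{Z_{a,b,j}\}_{1\le a,b\le 3,\ 1\le j\le n}$ be independent standard Gaussian random variables and define the random $2^n\times 2^n$ Hermitian matrix \[H_n:=\frac{1}{\sqrt{9n}}\sum_{j=1}^n\sum_{a,b=1}^3 Z_{a,b,j}\,\sigma^{(a)}_j\sigma^{(b)}_{j+1},\qquad \sigma^{(a)}_j:=I_2^{\otimes(j-1)}\otimes\sigma^{(a)}\otimes I_2^{\otimes(n-j)},\] where the labelling is cyclic ($\sigma^{(b)}_{n+1}:=\sigma^{(b)}_1$), $I_2$ is the $2\times2$ identity matrix and \[\sigma^{(1)}=\begin{bmatrix}0&1\\1&0\end{bmatrix},\quad \sigma^{(2)}=\begin{bmatrix}0&-i\\i&0\end{bmatrix},\quad \sigma^{(3)}=\begin{bmatrix}1&0\\0&-1\end{bmatrix}.\] Let $\mu_n:=2^{-n}\sum_{k=1}^{2^n}\delta_{\lambda_k}$ be its empirical spectral measure, where $\lambda_1,\dots,\lambda_{2^n}$ are the eigenvalues of $H_n$ with multiplicity, and let $\gamma$ be the standard Gaussian distribution on $\mathbb{R}$. For probability measures $\mu,\nu$ on $\mathbb{R}$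 let \[d_{BL}(\mu,\nu):=\sup\left\{\left|\int f\,d\mu-\int f\,d\nu\right| : f:\mathbb{R}\to\mathbb{R},\ \|f\|_\infty+|f|_L\le 1\right\},\] where $|f|_L$ is the Lipschitz constant of $f$. Then there are universal constants $C,C',c>0$ such that: (a) for every $n\ge2$, $\displaystyle \mathbb{E}\,d_{BL}(\mu_n,\gamma)\le \frac{C}{n^{1/6}}$; (b) for every $n\ge2$ and every $t\ge0$, $\displaystyle \mathbb{P}\left[d_{BL}(\mu_n,\gamma)\ge\frac{C}{n^{1/6}}+t\right]\le Ce^{-cnt^2}$; (c) if the matrices $H_n$, $n\ge2$, are all defined on one probability space (with an arbitrary joint distribution of the coefficients for different $n$), then with probability $1$, $\displaystyle d_{BL}(\mu_n,\gamma)\le \frac{C'}{n^{1/6}}$ for all sufficiently large $n$. -/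

import Mathlib

open MeasureTheory ProbabilityTheory Filter Topology
open scoped ENNReal NNReal

universe u

noncomputable section

/-- The three non-trivial Pauli matrices `σ⁽¹⁾, σ⁽²⁾, σ⁽³⁾`. -/
def pauli : Fin 3 → Matrix (Fin 2) (Fin 2) ℂ :=
  ![!![0, 1; 1, 0], !![0, -Complex.I; Complex.I, 0], !![1, 0; 0, -1]]

/-- The Kronecker product `A₁ ⊗ ⋯ ⊗ Aₙ` of `n` matrices of size `2 × 2`. The rows and the columns
of this `2ⁿ × 2ⁿ` matrix are indexed by the functions `Fin n → Fin 2`. -/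
def tensorProd {n : ℕ} (A : Fin n → Matrix (Fin 2) (Fin 2) ℂ) :
    Matrix (Fin n → Fin 2) (Fin n → Fin 2) ℂ :=
  Matrix.of fun s t => ∏ k, A k (s k) (t k)

/-- `I₂ ⊗ ⋯ ⊗ I₂ ⊗ σ⁽ᵃ⁾ ⊗ I₂ ⊗ ⋯ ⊗ I₂`, with `σ⁽ᵃ⁾` in position `j`. -/
def sitePauli {n : ℕ} (a : Fin 3) (j : Fin n) : Matrix (Fin n → Fin 2) (Fin n → Fin 2) ℂ :=
  tensorProd (Function.update (fun _ => 1) j (pauli a))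

/-- The nearest-neighbour Hamiltonian on the cyclic chain of `n` sites with the coupling
coefficients `x a b j`; `finRotate n` sends `j` to `j + 1` cyclically. -/
def hamiltonian {n : ℕ} (x : Fin 3 → Fin 3 → Fin n → ℝ) :
    Matrix (Fin n → Fin 2) (Fin n → Fin 2) ℂ :=
  ((1 / Real.sqrt (9 * n) : ℝ) : ℂ) • ∑ j : Fin n, ∑ a : Fin 3, ∑ b : Fin 3,
    ((x a b j : ℝ) : ℂ) • (sitePauli a j * sitePauli b (finRotate n j))

theorem pauli_isHermitian (a : Fin 3) : (pauli a).IsHermitian := by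
  fin_cases a <;> ext i j <;> fin_cases i <;> fin_cases j <;>
    simp [pauli, Matrix.conjTranspose_apply]

theorem tensorProd_mul {n : ℕ} (A B : Fin n → Matrix (Fin 2) (Fin 2) ℂ) :
    tensorProd A * tensorProd B = tensorProd (fun k => A k * B k) := by
  ext s t
  simp only [tensorProd, Matrix.mul_apply, Matrix.of_apply, ← Finset.prod_mul_distrib]
  rw [Finset.prod_univ_sum]
  simp

theorem sitePauli_isHermitian {n : ℕ} (a : Fin 3) (j : Fin n) : (sitePauli a j).IsHermitian := by
  ext s t
  simp only [sitePauli, tensorProd, Matrix.conjTranspose_apply, Matrix.of_apply, star_prod]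
  refine Finset.prod_congr rfl fun k _ => ?_
  by_cases h : k = j
  · subst h
    simpa using (pauli_isHermitian a).apply (s k) (t k)
  · simp only [Function.update_of_ne h]
    exact Matrix.isHermitian_one.apply (s k) (t k)

theorem sitePauli_commute {n : ℕ} (a b : Fin 3) {j k : Fin n} (h : j ≠ k) :
    Commute (sitePauli a j) (sitePauli b k) := by
  simp only [Commute, SemiconjBy, sitePauli, tensorProd_mul]
  congr 1
  funext i
  by_cases hj : i = j
  · subst hj
    simp [Function.update_of_ne h]
  · simp [Function.update_of_ne hj]

theorem finRotate_ne_self {n : ℕ} (hn : 2 ≤ n) (j : Fin n) : j ≠ finRotate n j := by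
  obtain ⟨m, rfl⟩ : ∃ m, n = m + 2 := ⟨n - 2, by omega⟩
  rw [finRotate_apply]
  intro h
  simp at h

/-- For `n ≥ 2` the Hamiltonian is Hermitian. (For `n = 1` it need not be.) -/
theorem hamiltonian_isHermitian {n : ℕ} (hn : 2 ≤ n) (x : Fin 3 → Fin 3 → Fin n → ℝ) :
    (hamiltonian x).IsHermitian := by
  have key : ∀ (a b : Fin 3) (j : Fin n),
      (sitePauli a j * sitePauli b (finRotate n j)).IsHermitian := fun a b j => by
    rw [Matrix.IsHermitian, Matrix.conjTranspose_mul, (sitePauli_isHermitian _ _).eq,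
      (sitePauli_isHermitian _ _).eq]
    exact (sitePauli_commute a b (finRotate_ne_self hn j)).eq.symm
  simp only [Matrix.IsHermitian, hamiltonian, Matrix.conjTranspose_smul,
    Matrix.conjTranspose_sum, (key _ _ _).eq, Complex.star_def, Complex.conj_ofReal]

/-- The empirical spectral measure of a Hermitian matrix: equal mass at each eigenvalue, counted
with multiplicity. -/
def spectralMeasure {ι : Type*} [Fintype ι] [DecidableEq ι] {A : Matrix ι ι ℂ}
    (hA : A.IsHermitian) : Measure ℝ :=
  (Fintype.card ι : ℝ≥0∞)⁻¹ • ∑ i, Measure.dirac (hA.eigenvalues i)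

/-- The empirical spectral measure of the Hamiltonian with coupling coefficients `x`. -/
def chainMeasure {n : ℕ} (hn : 2 ≤ n) (x : Fin 3 → Fin 3 → Fin n → ℝ) : Measure ℝ :=
  spectralMeasure (hamiltonian_isHermitian hn x)

/-- The bounded-Lipschitz norm `‖f‖_∞ + |f|_L` (possibly infinite), where `|f|_L` is the
smallest Lipschitz constant of `f`. -/
def blNorm (f : ℝ → ℝ) : ℝ≥0∞ :=
  (⨆ x, ‖f x‖ₑ) + ⨆ (x) (y), edist (f x) (f y) / edist x y

/-- The bounded-Lipschitz distance between probability measures on `ℝ`. -/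
def dBL (μ ν : Measure ℝ) : ℝ :=
  sSup {r : ℝ | ∃ f : ℝ → ℝ, blNorm f ≤ 1 ∧ r = |∫ x, f x ∂μ - ∫ x, f x ∂ν|}

/-- The `9n` coefficients `Z a b j` are independent standard Gaussian random variables. -/
structure IsGaussianCoupling {Ω : Type u} [MeasurableSpace Ω] (P : Measure Ω) {n : ℕ}
    (Z : Fin 3 → Fin 3 → Fin n → Ω → ℝ) : Prop where
  indep : iIndepFun (fun i : Fin 3 × Fin 3 × Fin n => Z i.1 i.2.1 i.2.2) P
  law : ∀ a b j, HasLaw (Z a b j) (gaussianReal 0 1) P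

end

/-!
Write `H = N ^ (-1 / 2) • ∑ k, x k • b k` for Hermitian involutions `b k` that are orthogonal for
the trace and each of which commutes with all but boundedly many others.

*Concentration.* Both `tr f(H)`, for `f` Lipschitz, and the bounded-Lipschitz distance itself are
`N ^ (-1 / 2)`-Lipschitz in the coefficients, because the squared overlaps of the eigenvectors of
two Hermitian matrices couple their spectral measures at quadratic cost the normalised squared
Hilbert–Schmidt distance of the matrices. Rotating a Gaussian vector into an independent copy
(Maurey–Pisier) turns this into subgaussian tails.

*Mean of one statistic.* Let `f` solve Stein's equation `f' t - t * f t = s t - ∫ s ∂γ`. In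
`tr (H f(H)) = N ^ (-1 / 2) ∑ k, x k tr (b k f(H))` expand `f(H)` about the operator `H'` obtained
by setting `x k = 0`. The zeroth order term `x k tr (b k f(H'))` has mean zero by independence.
Since `b k ^ 2 = 1`, the first order term is `N ^ (-1 / 2) (x k) ^ 2 tr f'(H')`, with mean that of
`N ^ (-1 / 2) tr f'(H')`, up to a commutator of `H` with `b k`, which is small by locality.

*From single functions to the distance.* Interpolating a test function linearly on a grid of about
`N ^ (1 / 3)` cells of size `N ^ (-1 / 6)` writes it as a combination of ramps, so that the
distance is at most a multiple of `N ^ (-1 / 6)` plus the sum over the ramps of deviations of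
order `N ^ (-1 / 2)`. The tails are summable at `t = n ^ (-1 / 6)`, which gives the almost sure
bound.

The interaction terms of the chain are such a family for `n ≥ 3`; for `n = 2` they are linearly
dependent, but there the bounds hold trivially because the distance is at most `2`.
-/

noncomputable section

section RotationIncrement

open scoped Real
open ContinuousLinearMap (rotation)

variable {E : Type*} [NormedAddCommGroup E] [NormedSpace ℝ E] {F : E → ℝ} {L : ℝ≥0}

/-- The increment of `F` along the arc of angle `θ` that leaves `p.1` in the direction of `p.2`,
in the interpolation between two independent copies of a Gaussian vector. -/
def rotationIncrement (F : E → ℝ) (θ : ℝ) (p : E × E) : ℝ :=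
  F (rotation θ p).1 - F p.1

theorem fst_rotation_apply (θ : ℝ) (p : E × E) :
    (rotation θ p).1 = Real.cos θ • p.1 + Real.sin θ • p.2 := rfl

theorem rotationIncrement_pi_div_two (F : E → ℝ) (p : E × E) :
    rotationIncrement F (π / 2) p = F p.2 - F p.1 := by
  simp [rotationIncrement, fst_rotation_apply]

theorem fst_rotation_rotation (θ φ : ℝ) (p : E × E) :
    (rotation θ (rotation φ p)).1 = (rotation (φ + θ) p).1 := by
  simp only [ContinuousLinearMap.rotation_apply, Real.cos_add, Real.sin_add]
  module

theorem sum_rotationIncrement (F : E → ℝ) (θ : ℝ) {m : ℕ} (hm : m ≠ 0) (p : E × E) :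
    ∑ k ∈ Finset.range m, rotationIncrement F (θ / m) (rotation (k * (θ / m)) p)
      = rotationIncrement F θ p := by
  have hstep (k : ℕ) : rotationIncrement F (θ / m) (rotation (k * (θ / m)) p)
      = F (rotation ((k + 1 : ℕ) * (θ / m)) p).1 - F (rotation (k * (θ / m)) p).1 := by
    rw [rotationIncrement, fst_rotation_rotation]
    push_cast
    ring_nf
  simp_rw [hstep]
  rw [Finset.sum_range_sub (fun k : ℕ => F (rotation (k * (θ / m)) p).1), rotationIncrement,
    mul_div_cancel₀ θ (Nat.cast_ne_zero.2 hm)]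
  simp [fst_rotation_apply]

theorem continuous_rotationIncrement (hF : Continuous F) (θ : ℝ) :
    Continuous (rotationIncrement F θ) := by
  unfold rotationIncrement
  fun_prop

theorem abs_rotationIncrement_le (hF : LipschitzWith L F) (θ : ℝ) (p : E × E) :
    |rotationIncrement F θ p| ≤ 2 * L * |θ| * ‖p‖ := by
  have hcos : |Real.cos θ - 1| ≤ |θ| := by simpa using Real.abs_cos_sub_cos_le θ 0
  have hdiff : (rotation θ p).1 - p.1 = (Real.cos θ - 1) • p.1 + Real.sin θ • p.2 := by
    rw [fst_rotation_apply]
    module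
  calc |rotationIncrement F θ p| ≤ L * ‖(rotation θ p).1 - p.1‖ := by
        rw [rotationIncrement, ← Real.dist_eq, ← dist_eq_norm]
        exact hF.dist_le_mul _ _
    _ ≤ L * (|θ| * ‖p‖ + |θ| * ‖p‖) := by
        rw [hdiff]
        refine mul_le_mul_of_nonneg_left ((norm_add_le _ _).trans ?_) L.2
        rw [norm_smul, norm_smul]
        gcongr
        · exact hcos
        · exact norm_fst_le p
        · exact Real.abs_sin_le_abs
        · exact norm_snd_le p
    _ = 2 * L * |θ| * ‖p‖ := by ring

theorem abs_mul_rotationIncrement_div_le (hF : LipschitzWith L F) (θ : ℝ) (m : ℕ) (p : E × E) :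
    |m * rotationIncrement F (θ / m) p| ≤ 2 * L * |θ| * ‖p‖ := by
  rcases m.eq_zero_or_pos with rfl | hm
  · simp only [CharP.cast_eq_zero, zero_mul, abs_zero]
    positivity
  · calc |m * rotationIncrement F (θ / m) p| ≤ m * (2 * L * |θ / m| * ‖p‖) := by
          rw [abs_mul, Nat.abs_cast]
          gcongr
          exact abs_rotationIncrement_le hF _ p
      _ = 2 * L * |θ| * ‖p‖ := by
          rw [abs_div, Nat.abs_cast]
          field_simp

theorem tendsto_mul_rotationIncrement_div {p : E × E} (h : DifferentiableAt ℝ F p.1) (θ : ℝ) :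
    Tendsto (fun m : ℕ => m * rotationIncrement F (θ / m) p) atTop
      (𝓝 (θ * fderiv ℝ F p.1 p.2)) := by
  have hpath : HasDerivAt (fun s : ℝ => (rotation (s * θ) p).1) (θ • p.2) 0 := by
    have hθ : HasDerivAt (fun s : ℝ => s * θ) θ 0 := by simpa using (hasDerivAt_id 0).mul_const θ
    have hrot := (hθ.cos.smul_const p.1).add (hθ.sin.smul_const p.2)
    exact HasDerivAt.congr_deriv hrot (by simp)
  have hF : HasFDerivAt F (fderiv ℝ F p.1) (rotation ((0 : ℝ) * θ) p).1 := by
    simpa [fst_rotation_apply] using h.hasFDerivAt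
  have hinv : Tendsto (fun m : ℕ => (m : ℝ)⁻¹) atTop (𝓝[≠] 0) :=
    tendsto_nhdsWithin_iff.2 ⟨tendsto_inv_atTop_nhds_zero_nat, by
      filter_upwards [eventually_ne_atTop 0] with m hm
      simpa using hm⟩
  have hslope := (hF.comp_hasDerivAt (0 : ℝ) hpath).tendsto_slope_zero.comp hinv
  rw [map_smul, smul_eq_mul] at hslope
  refine hslope.congr fun m => ?_
  simp [rotationIncrement, fst_rotation_apply, div_eq_inv_mul]

/-- Jensen's inequality along the decomposition of the arc into `m` equal pieces. -/
theorem exp_rotationIncrement_le_sum (F : E → ℝ) (θ : ℝ) {m : ℕ} (hm : m ≠ 0) (p : E × E) :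
    Real.exp (rotationIncrement F θ p) ≤ ∑ k ∈ Finset.range m,
      (m : ℝ)⁻¹ * Real.exp (m * rotationIncrement F (θ / m) (rotation (k * (θ / m)) p)) := by
  have hm' : (m : ℝ) ≠ 0 := Nat.cast_ne_zero.2 hm
  have hmean : rotationIncrement F θ p = ∑ k ∈ Finset.range m,
      (m : ℝ)⁻¹ • (m * rotationIncrement F (θ / m) (rotation (k * (θ / m)) p)) := by
    simp only [smul_eq_mul, inv_mul_cancel_left₀ hm', sum_rotationIncrement F θ hm p]
  rw [hmean]
  exact convexOn_exp.map_sum_le (fun _ _ => by positivity) (by simp [hm']) fun _ _ => Set.mem_univ _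

end RotationIncrement

section MaureyPisier

open scoped Real
open ContinuousLinearMap (rotation)

theorem integrable_exp_of_abs_le_mul_norm {E : Type*} [NormedAddCommGroup E] [NormedSpace ℝ E]
    [CompleteSpace E] [SecondCountableTopology E] [MeasurableSpace E] [BorelSpace E]
    {μ : Measure E} [IsGaussian μ] {g : E → ℝ} (hg : AEStronglyMeasurable g μ) {a b : ℝ}
    (h : ∀ x, |g x| ≤ a + b * ‖x‖) : Integrable (fun x => Real.exp (g x)) μ := by
  obtain ⟨C, hC, hint⟩ := IsGaussian.exists_integrable_exp_sq μ
  refine (hint.const_mul (Real.exp (a + b ^ 2 / (4 * C)))).mono'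
    (Real.continuous_exp.comp_aestronglyMeasurable hg) (ae_of_all _ fun x => ?_)
  rw [Real.norm_eq_abs, Real.abs_exp, ← Real.exp_add, Real.exp_le_exp]
  have hsq : b ^ 2 / (4 * C) + C * ‖x‖ ^ 2 - b * ‖x‖ = (b - 2 * C * ‖x‖) ^ 2 / (4 * C) := by
    field_simp
    ring
  have hnonneg : 0 ≤ (b - 2 * C * ‖x‖) ^ 2 / (4 * C) := by positivity
  linarith [h x, le_abs_self (g x)]

theorem pi_absolutelyContinuous_pi {d : ℕ} {X : Fin d → Type*} [∀ i, MeasurableSpace (X i)]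
    {μ ν : ∀ i, Measure (X i)} [∀ i, SigmaFinite (μ i)] [∀ i, SigmaFinite (ν i)]
    (h : ∀ i, μ i ≪ ν i) : Measure.pi μ ≪ Measure.pi ν := by
  induction d with
  | zero => rw [Measure.pi_of_empty, Measure.pi_of_empty]
  | succ d ih =>
    rw [← (measurePreserving_piFinSuccAbove μ 0).symm.map_eq,
      ← (measurePreserving_piFinSuccAbove ν 0).symm.map_eq]
    exact ((h 0).prod (ih fun i => h _)).map (MeasurableEquiv.measurable _)

variable {E : Type*} [NormedAddCommGroup E] [InnerProductSpace ℝ E] [FiniteDimensional ℝ E]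
  [MeasurableSpace E] [BorelSpace E] {F : E → ℝ} {L : ℝ≥0}

theorem stdGaussian_absolutelyContinuous : stdGaussian E ≪ (volume : Measure E) := by
  let e := (stdOrthonormalBasis ℝ E).repr
  have heucl : stdGaussian (EuclideanSpace ℝ (Fin (Module.finrank ℝ E))) ≪ volume := by
    rw [← map_pi_eq_stdGaussian, ← (PiLp.volume_preserving_toLp _).map_eq, volume_pi]
    exact (pi_absolutelyContinuous_pi fun i =>
      gaussianReal_absolutelyContinuous _ one_ne_zero).map (by fun_prop)
  rw [← stdGaussian_map e.symm, ← (e.symm.measurePreserving).map_eq]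
  exact heucl.map e.symm.continuous.measurable

theorem integral_exp_dual_stdGaussian (l : StrongDual ℝ E) :
    ∫ y, Real.exp (l y) ∂stdGaussian E = Real.exp (‖l‖ ^ 2 / 2) := by
  have h := mgf_gaussianReal (IsGaussian.map_eq_gaussianReal (μ := stdGaussian E) l) 1
  simpa [mgf, variance_dual_stdGaussian] using h

theorem integrable_exp_mul_rotationIncrement_div (hF : LipschitzWith L F) (θ : ℝ) (m : ℕ) :
    Integrable (fun p => Real.exp (m * rotationIncrement F (θ / m) p))
      ((stdGaussian E).prod (stdGaussian E)) := by
  have hcont := continuous_rotationIncrement hF.continuous (θ / m)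
  refine integrable_exp_of_abs_le_mul_norm (a := 0) (b := 2 * L * |θ|)
    (by fun_prop) fun p => ?_
  simpa using abs_mul_rotationIncrement_div_le hF θ m p

theorem integral_exp_rotationIncrement_le_div (hF : LipschitzWith L F) (θ : ℝ) {m : ℕ}
    (hm : m ≠ 0) :
    ∫ p, Real.exp (rotationIncrement F θ p) ∂(stdGaussian E).prod (stdGaussian E)
      ≤ ∫ p, Real.exp (m * rotationIncrement F (θ / m) p)
          ∂(stdGaussian E).prod (stdGaussian E) := by
  set γ := (stdGaussian E).prod (stdGaussian E)
  set G : E × E → ℝ := fun p => Real.exp (m * rotationIncrement F (θ / m) p)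
  have hG : Integrable G γ := integrable_exp_mul_rotationIncrement_div hF θ m
  have hrot (φ : ℝ) : MeasurePreserving (rotation (E := E) φ) γ γ :=
    ⟨(rotation φ).continuous.measurable, IsGaussian.map_rotation_eq_self (by simp) φ⟩
  have hGrot (φ : ℝ) : Integrable (fun p => G (rotation φ p)) γ :=
    (hrot φ).integrable_comp_of_integrable hG
  have hGint (φ : ℝ) : ∫ p, G (rotation φ p) ∂γ = ∫ p, G p ∂γ := by
    rw [← integral_map (hrot φ).aemeasurable, (hrot φ).map_eq]
    rw [(hrot φ).map_eq]
    exact hG.aestronglyMeasurable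
  calc ∫ p, Real.exp (rotationIncrement F θ p) ∂γ
      ≤ ∫ p, ∑ k ∈ Finset.range m, (m : ℝ)⁻¹ * G (rotation (k * (θ / m)) p) ∂γ :=
        integral_mono_of_nonneg (ae_of_all _ fun p => (Real.exp_pos _).le)
          (integrable_finsetSum _ fun k _ => (hGrot _).const_mul _)
          (ae_of_all _ fun p => exp_rotationIncrement_le_sum F θ hm p)
    _ = ∫ p, G p ∂γ := by
        rw [integral_finsetSum _ fun k _ => (hGrot _).const_mul _]
        simp only [integral_const_mul, hGint, Finset.sum_const, Finset.card_range, nsmul_eq_mul]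
        field_simp

theorem integral_exp_rotationIncrement_le (hF : LipschitzWith L F) (θ : ℝ) :
    ∫ p, Real.exp (rotationIncrement F θ p) ∂(stdGaussian E).prod (stdGaussian E)
      ≤ ∫ p, Real.exp (θ * fderiv ℝ F p.1 p.2) ∂(stdGaussian E).prod (stdGaussian E) := by
  have hdiff : ∀ᵐ p ∂(stdGaussian E).prod (stdGaussian E), DifferentiableAt ℝ F p.1 :=
    Measure.quasiMeasurePreserving_fst.ae
      (stdGaussian_absolutelyContinuous.ae_le hF.ae_differentiableAt)
  have hdom : Integrable (fun p : E × E => Real.exp (2 * L * |θ| * ‖p‖))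
      ((stdGaussian E).prod (stdGaussian E)) :=
    integrable_exp_of_abs_le_mul_norm (a := 0) (b := 2 * L * |θ|) (by fun_prop) fun p => by
      rw [zero_add, abs_of_nonneg (by positivity)]
  refine ge_of_tendsto (tendsto_integral_of_dominated_convergence _
    (fun m => (integrable_exp_mul_rotationIncrement_div hF θ m).aestronglyMeasurable) hdom
    (fun m => ae_of_all _ fun p => ?_) ?_)
    ((eventually_ne_atTop 0).mono fun m hm => integral_exp_rotationIncrement_le_div hF θ hm)
  · rw [Real.norm_eq_abs, Real.abs_exp, Real.exp_le_exp]
    exact (le_abs_self _).trans (abs_mul_rotationIncrement_div_le hF θ m p)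
  · filter_upwards [hdiff] with p hp
    exact (Real.continuous_exp.tendsto _).comp (tendsto_mul_rotationIncrement_div hp θ)

theorem integrable_exp_mul_fderiv (hF : LipschitzWith L F) (θ : ℝ) :
    Integrable (fun p : E × E => Real.exp (θ * fderiv ℝ F p.1 p.2))
      ((stdGaussian E).prod (stdGaussian E)) := by
  have hmeas : Measurable fun p : E × E => fderiv ℝ F p.1 p.2 :=
    ContinuousLinearMap.measurable_apply₂.comp
      (((measurable_fderiv ℝ F).comp measurable_fst).prodMk measurable_snd)
  refine integrable_exp_of_abs_le_mul_norm (a := 0) (b := |θ| * L)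
    (hmeas.const_mul θ).aestronglyMeasurable fun p => ?_
  have hderiv : |fderiv ℝ F p.1 p.2| ≤ L * ‖p‖ :=
    ((fderiv ℝ F p.1).le_opNorm p.2).trans (mul_le_mul (norm_fderiv_le_of_lipschitz ℝ hF)
      (norm_snd_le p) (norm_nonneg _) L.2)
  rw [abs_mul, zero_add, mul_assoc]
  gcongr

theorem integral_exp_mul_fderiv_le (hF : LipschitzWith L F) (θ : ℝ) :
    ∫ p, Real.exp (θ * fderiv ℝ F p.1 p.2) ∂(stdGaussian E).prod (stdGaussian E)
      ≤ Real.exp ((θ * L) ^ 2 / 2) := by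
  have hint := integrable_exp_mul_fderiv hF θ
  have hinner (x : E) : ∫ y, Real.exp (θ * fderiv ℝ F x y) ∂stdGaussian E
      ≤ Real.exp ((θ * L) ^ 2 / 2) := by
    have h := integral_exp_dual_stdGaussian (θ • fderiv ℝ F x)
    simp only [smul_apply, smul_eq_mul] at h
    rw [h, norm_smul, Real.norm_eq_abs, mul_pow, sq_abs, mul_pow]
    gcongr
    exact norm_fderiv_le_of_lipschitz ℝ hF
  calc ∫ p, Real.exp (θ * fderiv ℝ F p.1 p.2) ∂(stdGaussian E).prod (stdGaussian E)
      = ∫ x, ∫ y, Real.exp (θ * fderiv ℝ F x y) ∂stdGaussian E ∂stdGaussian E :=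
        integral_prod _ hint
    _ ≤ ∫ _, Real.exp ((θ * L) ^ 2 / 2) ∂stdGaussian E :=
        integral_mono hint.integral_prod_left (integrable_const _) hinner
    _ = Real.exp ((θ * L) ^ 2 / 2) := by simp

theorem integral_exp_sub_le (hF : LipschitzWith L F) :
    ∫ p, Real.exp (F p.2 - F p.1) ∂(stdGaussian E).prod (stdGaussian E)
      ≤ Real.exp ((π / 2 * L) ^ 2 / 2) := by
  simp_rw [← rotationIncrement_pi_div_two F]
  exact (integral_exp_rotationIncrement_le hF _).trans (integral_exp_mul_fderiv_le hF _)

theorem integrable_exp_of_lipschitzWith (hF : LipschitzWith L F) :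
    Integrable (fun x => Real.exp (F x)) (stdGaussian E) := by
  refine integrable_exp_of_abs_le_mul_norm (a := |F 0|) (b := L)
    hF.continuous.aestronglyMeasurable fun x => ?_
  have h := hF.dist_le_mul x 0
  rw [Real.dist_eq, dist_zero_right] at h
  linarith [abs_sub_abs_le_abs_sub (F x) (F 0)]

theorem integrable_stdGaussian_of_lipschitzWith (hF : LipschitzWith L F) :
    Integrable F (stdGaussian E) := by
  refine ((integrable_exp_of_lipschitzWith hF).add (integrable_exp_of_lipschitzWith hF.neg)).mono'
    hF.continuous.aestronglyMeasurable (ae_of_all _ fun x => ?_)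
  simp only [Pi.add_apply, Pi.neg_apply, Real.norm_eq_abs]
  exact abs_le'.2 ⟨by linarith [Real.add_one_le_exp (F x), Real.exp_pos (-F x)],
    by linarith [Real.add_one_le_exp (-F x), Real.exp_pos (F x)]⟩

/-- Jensen's inequality over an independent copy removes the centring. -/
theorem integral_exp_sub_integral_le (hF : LipschitzWith L F) :
    ∫ x, Real.exp (F x - ∫ y, F y ∂stdGaussian E) ∂stdGaussian E
      ≤ Real.exp ((π / 2 * L) ^ 2 / 2) := by
  set a := ∫ y, F y ∂stdGaussian E
  have hconst : LipschitzWith 0 fun _ : E => a := LipschitzWith.const a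
  have hjensen : 1 ≤ ∫ x, Real.exp (a - F x) ∂stdGaussian E := by
    have hcentred : ∫ x, (a - F x) ∂stdGaussian E = 0 := by
      rw [integral_sub (integrable_const a) (integrable_stdGaussian_of_lipschitzWith hF)]
      simp [a]
    have h := convexOn_exp.map_integral_le Real.continuous_exp.continuousOn isClosed_univ
      (ae_of_all _ fun x => Set.mem_univ (a - F x))
      (integrable_stdGaussian_of_lipschitzWith (hconst.sub hF))
      (integrable_exp_of_lipschitzWith (hconst.sub hF))
    rwa [hcentred, Real.exp_zero] at h
  calc ∫ x, Real.exp (F x - a) ∂stdGaussian E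
      ≤ (∫ x, Real.exp (a - F x) ∂stdGaussian E) * ∫ x, Real.exp (F x - a) ∂stdGaussian E :=
        le_mul_of_one_le_left (integral_nonneg fun x => (Real.exp_pos _).le) hjensen
    _ = ∫ p, Real.exp (F p.2 - F p.1) ∂(stdGaussian E).prod (stdGaussian E) := by
        rw [← integral_prod_mul]
        refine integral_congr_ae (ae_of_all _ fun p => ?_)
        simp only [← Real.exp_add]
        ring_nf
    _ ≤ Real.exp ((π / 2 * L) ^ 2 / 2) := integral_exp_sub_le hF

theorem hasSubgaussianMGF_stdGaussian (hF : LipschitzWith L F) :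
    HasSubgaussianMGF (fun x => F x - ∫ y, F y ∂stdGaussian E) ((NNReal.pi / 2 * L) ^ 2)
      (stdGaussian E) where
  integrable_exp_mul t := integrable_exp_of_lipschitzWith
    ((lipschitzWith_smul t).comp (hF.sub (LipschitzWith.const _)))
  mgf_le t := by
    have h := integral_exp_sub_integral_le ((lipschitzWith_smul t).comp hF)
    simp only [Function.comp_apply, smul_eq_mul, integral_const_mul, ← mul_sub] at h
    refine h.trans_eq ?_
    push_cast
    rw [NNReal.coe_real_pi, Real.norm_eq_abs, ← sq_abs t]
    ring_nf

end MaureyPisier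

section Concentration

theorem integral_abs_le_of_hasSubgaussianMGF {Ω : Type*} {mΩ : MeasurableSpace Ω} {μ : Measure Ω}
    {X : Ω → ℝ} {K : ℝ≥0} (hK : K ≠ 0) (h : HasSubgaussianMGF X (K ^ 2) μ) :
    ∫ ω, |X ω| ∂μ ≤ 2 * Real.exp (1 / 2) * K := by
  have hK' : (0 : ℝ) < K := by positivity
  have hmgf (t : ℝ) (ht : t ^ 2 = (K : ℝ)⁻¹ ^ 2) :
      ∫ ω, Real.exp (t * X ω) ∂μ ≤ Real.exp (1 / 2) := by
    refine (h.mgf_le t).trans_eq ?_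
    rw [ht]
    push_cast
    field_simp
  have hexp (x : ℝ) : |x| ≤ K * (Real.exp ((K : ℝ)⁻¹ * x) + Real.exp (-(K : ℝ)⁻¹ * x)) := by
    have hle : |(K : ℝ)⁻¹ * x| ≤ Real.exp ((K : ℝ)⁻¹ * x) + Real.exp (-((K : ℝ)⁻¹ * x)) := by
      rw [abs_le']
      constructor <;> linarith [Real.add_one_le_exp ((K : ℝ)⁻¹ * x),
        Real.add_one_le_exp (-((K : ℝ)⁻¹ * x)), Real.exp_pos ((K : ℝ)⁻¹ * x),
        Real.exp_pos (-((K : ℝ)⁻¹ * x))]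
    rwa [abs_mul, abs_of_pos (inv_pos.2 hK'), inv_mul_le_iff₀ hK', ← neg_mul] at hle
  have hint := (h.integrable_exp_mul (K : ℝ)⁻¹).add (h.integrable_exp_mul (-(K : ℝ)⁻¹))
  calc ∫ ω, |X ω| ∂μ
      ≤ ∫ ω, K * (Real.exp ((K : ℝ)⁻¹ * X ω) + Real.exp (-(K : ℝ)⁻¹ * X ω)) ∂μ :=
        integral_mono_of_nonneg (ae_of_all _ fun ω => abs_nonneg _) (hint.const_mul _)
          (ae_of_all _ fun ω => hexp (X ω))
    _ ≤ K * (Real.exp (1 / 2) + Real.exp (1 / 2)) := by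
        rw [integral_const_mul, integral_add (h.integrable_exp_mul _) (h.integrable_exp_mul _)]
        gcongr
        · exact hmgf _ rfl
        · exact hmgf _ (neg_sq _)
    _ = 2 * Real.exp (1 / 2) * K := by ring

/-- The law of a family, indexed by `κ`, of independent standard Gaussian random variables. -/
abbrev stdGaussianPi (κ : Type*) [Fintype κ] : Measure (κ → ℝ) :=
  Measure.pi fun _ => gaussianReal 0 1

variable {κ : Type*} [Fintype κ] {F : (κ → ℝ) → ℝ} {L : ℝ≥0}

theorem measurePreserving_toLp_stdGaussian :
    MeasurePreserving (WithLp.toLp 2 : (κ → ℝ) → EuclideanSpace ℝ κ) (stdGaussianPi κ)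
      (stdGaussian (EuclideanSpace ℝ κ)) :=
  ⟨by fun_prop, map_pi_eq_stdGaussian⟩

theorem integrable_stdGaussianPi_of_lipschitzWith
    (hF : LipschitzWith L fun x : EuclideanSpace ℝ κ => F x.ofLp) :
    Integrable F (stdGaussianPi κ) :=
  measurePreserving_toLp_stdGaussian.integrable_comp_of_integrable
    (integrable_stdGaussian_of_lipschitzWith hF)

theorem hasSubgaussianMGF_stdGaussianPi
    (hF : LipschitzWith L fun x : EuclideanSpace ℝ κ => F x.ofLp) :
    HasSubgaussianMGF (fun x => F x - ∫ y, F y ∂stdGaussianPi κ) ((NNReal.pi / 2 * L) ^ 2)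
      (stdGaussianPi κ) := by
  have h := hasSubgaussianMGF_stdGaussian hF
  rw [← measurePreserving_toLp_stdGaussian.map_eq, integral_map (by fun_prop)
    hF.continuous.aestronglyMeasurable] at h
  exact h.of_map (by fun_prop)

theorem integral_abs_sub_integral_stdGaussianPi_le (hL : L ≠ 0)
    (hF : LipschitzWith L fun x : EuclideanSpace ℝ κ => F x.ofLp) :
    ∫ x, |F x - ∫ y, F y ∂stdGaussianPi κ| ∂stdGaussianPi κ ≤ Real.pi * Real.exp (1 / 2) * L := by
  have hK : NNReal.pi / 2 * L ≠ 0 := by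
    have := NNReal.pi_pos
    positivity
  refine (integral_abs_le_of_hasSubgaussianMGF hK
    (hasSubgaussianMGF_stdGaussianPi hF)).trans_eq ?_
  push_cast
  rw [NNReal.coe_real_pi]
  ring

end Concentration

section HilbertSchmidt

open Matrix

variable {ι : Type*} [Fintype ι]

/-- The normalised squared Hilbert–Schmidt norm of a square matrix. -/
def hsNormSq (M : Matrix ι ι ℂ) : ℝ := (Fintype.card ι : ℝ)⁻¹ * ∑ i, ∑ j, ‖M i j‖ ^ 2

/-- The real part of the normalised trace, as a real-linear functional. -/
def ntr : Matrix ι ι ℂ →ₗ[ℝ] ℝ :=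
  (Fintype.card ι : ℝ)⁻¹ • Complex.reLm ∘ₗ Matrix.traceLinearMap ι ℝ ℂ

theorem ntr_apply (M : Matrix ι ι ℂ) : ntr M = (Fintype.card ι : ℝ)⁻¹ * M.trace.re := rfl

theorem ntr_mul_comm (M N : Matrix ι ι ℂ) : ntr (M * N) = ntr (N * M) := by
  rw [ntr_apply, ntr_apply, trace_mul_comm]

theorem ntr_one [DecidableEq ι] [Nonempty ι] : ntr (1 : Matrix ι ι ℂ) = 1 := by
  simp [ntr_apply]

theorem continuous_ntr : Continuous (ntr : Matrix ι ι ℂ → ℝ) :=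
  ntr.continuous_of_finiteDimensional

theorem hsNormSq_nonneg (M : Matrix ι ι ℂ) : 0 ≤ hsNormSq M := by
  unfold hsNormSq; positivity

theorem hsNormSq_eq_ntr (M : Matrix ι ι ℂ) : hsNormSq M = ntr (M * Mᴴ) := by
  simp only [hsNormSq, ntr_apply, trace, diag_apply, mul_apply, conjTranspose_apply,
    Complex.star_def, Complex.mul_conj, Complex.normSq_eq_norm_sq, Complex.re_sum,
    Complex.ofReal_re]

theorem hsNormSq_smul (c : ℝ) (M : Matrix ι ι ℂ) : hsNormSq (c • M) = c ^ 2 * hsNormSq M := by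
  simp only [hsNormSq, Matrix.smul_apply, norm_smul, Real.norm_eq_abs, mul_pow, sq_abs,
    ← Finset.mul_sum]
  ring

theorem hsNormSq_neg (M : Matrix ι ι ℂ) : hsNormSq (-M) = hsNormSq M := by
  simp [hsNormSq]

theorem hsNormSq_sum_le {κ : Type*} (s : Finset κ) (M : κ → Matrix ι ι ℂ) :
    hsNormSq (∑ k ∈ s, M k) ≤ s.card * ∑ k ∈ s, hsNormSq (M k) := by
  have entry (i j : ι) : ‖(∑ k ∈ s, M k) i j‖ ^ 2 ≤ s.card * ∑ k ∈ s, ‖M k i j‖ ^ 2 := by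
    rw [Matrix.sum_apply]
    calc ‖∑ k ∈ s, M k i j‖ ^ 2 ≤ (∑ k ∈ s, ‖M k i j‖) ^ 2 := by gcongr; exact norm_sum_le _ _
      _ ≤ s.card * ∑ k ∈ s, ‖M k i j‖ ^ 2 := sq_sum_le_card_mul_sum_sq
  calc hsNormSq (∑ k ∈ s, M k)
      ≤ (Fintype.card ι : ℝ)⁻¹ * ∑ i, ∑ j, s.card * ∑ k ∈ s, ‖M k i j‖ ^ 2 := by
        unfold hsNormSq
        gcongr with i _ j _
        exact entry i j
    _ = s.card * ∑ k ∈ s, hsNormSq (M k) := by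
        simp only [hsNormSq, ← Finset.mul_sum, Finset.sum_comm (s := s)]
        ring

theorem hsNormSq_add_le (M N : Matrix ι ι ℂ) :
    hsNormSq (M + N) ≤ 2 * (hsNormSq M + hsNormSq N) := by
  simpa using hsNormSq_sum_le Finset.univ ![M, N]

theorem hsNormSq_sub_le (M N : Matrix ι ι ℂ) :
    hsNormSq (M - N) ≤ 2 * (hsNormSq M + hsNormSq N) := by
  simpa [sub_eq_add_neg, hsNormSq_neg] using hsNormSq_add_le M (-N)

theorem continuous_hsNormSq : Continuous (hsNormSq : Matrix ι ι ℂ → ℝ) := by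
  unfold hsNormSq
  fun_prop

theorem norm_entry_sq_le_hsNormSq (M : Matrix ι ι ℂ) (i j : ι) :
    ‖M i j‖ ^ 2 ≤ Fintype.card ι * hsNormSq M := by
  have : Nonempty ι := ⟨i⟩
  rw [hsNormSq, mul_inv_cancel_left₀ (by positivity)]
  calc ‖M i j‖ ^ 2 ≤ ∑ j, ‖M i j‖ ^ 2 :=
        Finset.single_le_sum (f := fun j => ‖M i j‖ ^ 2) (fun _ _ => by positivity)
          (Finset.mem_univ j)
    _ ≤ ∑ i, ∑ j, ‖M i j‖ ^ 2 :=
        Finset.single_le_sum (f := fun i => ∑ j, ‖M i j‖ ^ 2) (fun _ _ => by positivity)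
          (Finset.mem_univ i)

theorem abs_ntr_mul_le (M N : Matrix ι ι ℂ) :
    |ntr (M * N)| ≤ (hsNormSq M + hsNormSq N) / 2 := by
  have trace_le : ‖(M * N).trace‖ ≤ (∑ i, ∑ j, ‖M i j‖ ^ 2 + ∑ i, ∑ j, ‖N i j‖ ^ 2) / 2 := by
    rw [Finset.sum_comm (f := fun i j => ‖N i j‖ ^ 2), ← Finset.sum_add_distrib, Finset.sum_div]
    refine (norm_sum_le _ _).trans (Finset.sum_le_sum fun i _ => ?_)
    rw [← Finset.sum_add_distrib, Finset.sum_div]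
    refine (norm_sum_le _ _).trans (Finset.sum_le_sum fun j _ => ?_)
    rw [norm_mul]
    linarith [two_mul_le_add_sq ‖M i j‖ ‖N j i‖]
  calc |ntr (M * N)| = (Fintype.card ι : ℝ)⁻¹ * |(M * N).trace.re| := by
        rw [ntr_apply, abs_mul, abs_of_nonneg (by positivity)]
    _ ≤ (Fintype.card ι : ℝ)⁻¹ *
          ((∑ i, ∑ j, ‖M i j‖ ^ 2 + ∑ i, ∑ j, ‖N i j‖ ^ 2) / 2) := by
        gcongr
        exact (Complex.abs_re_le_norm _).trans trace_le
    _ = (hsNormSq M + hsNormSq N) / 2 := by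
        unfold hsNormSq
        ring

theorem hsNormSq_mul_of_conjTranspose_mul_self [DecidableEq ι] {U : Matrix ι ι ℂ}
    (hU : Uᴴ * U = 1) (M : Matrix ι ι ℂ) : hsNormSq (U * M) = hsNormSq M := by
  rw [hsNormSq_eq_ntr, hsNormSq_eq_ntr, conjTranspose_mul, Matrix.mul_assoc, ntr_mul_comm,
    Matrix.mul_assoc, Matrix.mul_assoc, hU, Matrix.mul_one]

theorem hsNormSq_of_conjTranspose_mul_self [DecidableEq ι] [Nonempty ι] {U : Matrix ι ι ℂ}
    (hU : Uᴴ * U = 1) : hsNormSq U = 1 := by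
  rw [hsNormSq_eq_ntr, ntr_mul_comm, hU, ntr_one]

end HilbertSchmidt

section DoubleOperatorIntegral

open Matrix

variable {ι : Type*} [Fintype ι] [DecidableEq ι] {A B : Matrix ι ι ℂ}

theorem continuousOn_real_spectrum (A : Matrix ι ι ℂ) (f : ℝ → ℝ) :
    ContinuousOn f (spectrum ℝ A) :=
  Matrix.finite_real_spectrum.continuousOn f

theorem cfc_eq_eigenvectorUnitary_mul (hA : A.IsHermitian) (f : ℝ → ℝ) :
    cfc f A = hA.eigenvectorUnitary.1 * diagonal (fun i => (f (hA.eigenvalues i) : ℂ)) *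
      star hA.eigenvectorUnitary.1 := by
  rw [hA.cfc_eq, Matrix.IsHermitian.cfc, Unitary.conjStarAlgAut_apply]
  rfl

theorem ntr_cfc_eq_sum (hA : A.IsHermitian) (f : ℝ → ℝ) :
    ntr (cfc f A) = (Fintype.card ι : ℝ)⁻¹ * ∑ i, f (hA.eigenvalues i) := by
  rw [cfc_eq_eigenvectorUnitary_mul hA, ntr_apply, trace_mul_cycle, Unitary.coe_star_mul_self]
  simp [Matrix.trace]

/-- The double operator integral of the symbol `Φ` with respect to `A` and `B`: in eigenbases of
`A` (on the left) and `B` (on the right) it multiplies the matrix of the identity entrywise by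
`Φ (λᵢ(A)) (λⱼ(B))`. -/
def doubleCfc (hA : A.IsHermitian) (hB : B.IsHermitian) (Φ : ℝ → ℝ → ℝ) : Matrix ι ι ℂ :=
  hA.eigenvectorUnitary.1 *
    of (fun i j => Φ (hA.eigenvalues i) (hB.eigenvalues j) •
      (star hA.eigenvectorUnitary.1 * hB.eigenvectorUnitary.1) i j) *
    star hB.eigenvectorUnitary.1

/-- The squared overlaps of the eigenvectors of `A` with those of `B`, normalised so that they
form a coupling of the two spectral measures. -/
def overlap (hA : A.IsHermitian) (hB : B.IsHermitian) (p : ι × ι) : ℝ :=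
  (Fintype.card ι : ℝ)⁻¹ *
    ‖(star hA.eigenvectorUnitary.1 * hB.eigenvectorUnitary.1) p.1 p.2‖ ^ 2

theorem overlap_nonneg (hA : A.IsHermitian) (hB : B.IsHermitian) (p : ι × ι) :
    0 ≤ overlap hA hB p := by
  unfold overlap; positivity

theorem doubleCfc_mul (hA : A.IsHermitian) (hB : B.IsHermitian) (f g : ℝ → ℝ) :
    doubleCfc hA hB (fun x y => f x * g y) = cfc f A * cfc g B := by
  set U := hA.eigenvectorUnitary.1 with hU
  set V := hB.eigenvectorUnitary.1 with hV
  have symbol : of (fun i j => (f (hA.eigenvalues i) * g (hB.eigenvalues j)) • (star U * V) i j) =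
      diagonal (fun i => (f (hA.eigenvalues i) : ℂ)) * (star U * V) *
        diagonal (fun i => (g (hB.eigenvalues i) : ℂ)) := by
    ext i j
    rw [mul_diagonal, diagonal_mul, of_apply, Complex.real_smul]
    push_cast
    ring
  rw [doubleCfc, ← hU, ← hV, symbol, cfc_eq_eigenvectorUnitary_mul hA,
    cfc_eq_eigenvectorUnitary_mul hB]
  simp only [Matrix.mul_assoc, hU, hV]

theorem doubleCfc_add (hA : A.IsHermitian) (hB : B.IsHermitian) (Φ Ψ : ℝ → ℝ → ℝ) :
    doubleCfc hA hB (fun x y => Φ x y + Ψ x y) = doubleCfc hA hB Φ + doubleCfc hA hB Ψ := by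
  simp only [doubleCfc, ← Matrix.add_mul, ← Matrix.mul_add]
  congr 2
  ext i j
  simp only [of_apply, Matrix.add_apply, add_smul]

theorem doubleCfc_sub (hA : A.IsHermitian) (hB : B.IsHermitian) (Φ Ψ : ℝ → ℝ → ℝ) :
    doubleCfc hA hB (fun x y => Φ x y - Ψ x y) = doubleCfc hA hB Φ - doubleCfc hA hB Ψ := by
  rw [eq_sub_iff_add_eq, ← doubleCfc_add]
  simp only [sub_add_cancel]

theorem doubleCfc_left (hA : A.IsHermitian) (hB : B.IsHermitian) (f : ℝ → ℝ) :
    doubleCfc hA hB (fun x _ => f x) = cfc f A := by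
  simpa [cfc_const_one ℝ B hB.isSelfAdjoint] using doubleCfc_mul hA hB f fun _ => 1

theorem doubleCfc_right (hA : A.IsHermitian) (hB : B.IsHermitian) (f : ℝ → ℝ) :
    doubleCfc hA hB (fun _ y => f y) = cfc f B := by
  simpa [cfc_const_one ℝ A hA.isSelfAdjoint] using doubleCfc_mul hA hB (fun _ => 1) f

theorem doubleCfc_one (hA : A.IsHermitian) (hB : B.IsHermitian) :
    doubleCfc hA hB (fun _ _ => 1) = 1 := by
  rw [doubleCfc_left hA hB fun _ => 1, cfc_const_one ℝ A hA.isSelfAdjoint]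

theorem ntr_doubleCfc_mul_conjTranspose (hA : A.IsHermitian) (hB : B.IsHermitian)
    (Φ Ψ : ℝ → ℝ → ℝ) :
    ntr (doubleCfc hA hB Φ * (doubleCfc hA hB Ψ)ᴴ) = ∑ p : ι × ι, overlap hA hB p *
      (Φ (hA.eigenvalues p.1) (hB.eigenvalues p.2) *
        Ψ (hA.eigenvalues p.1) (hB.eigenvalues p.2)) := by
  simp only [doubleCfc, overlap]
  set U := hA.eigenvectorUnitary.1
  set V := hB.eigenvectorUnitary.1
  set W := star U * V
  set P : Matrix ι ι ℂ := of fun i j => Φ (hA.eigenvalues i) (hB.eigenvalues j) • W i j with hP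
  set Q : Matrix ι ι ℂ := of fun i j => Ψ (hA.eigenvalues i) (hB.eigenvalues j) • W i j with hQ
  have hU : star U * U = 1 := Unitary.coe_star_mul_self _
  have hV : star V * V = 1 := Unitary.coe_star_mul_self _
  have conj : U * P * star V * (U * Q * star V)ᴴ = U * (P * Qᴴ) * star U := by
    calc U * P * star V * (U * Q * star V)ᴴ = U * P * (star V * V) * Qᴴ * star U := by
          simp only [conjTranspose_mul, star_eq_conjTranspose, conjTranspose_conjTranspose,
            Matrix.mul_assoc]
      _ = U * (P * Qᴴ) * star U := by rw [hV, Matrix.mul_one, Matrix.mul_assoc U]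
  have entry (i j : ι) : (P i j * star (Q i j)).re = ‖W i j‖ ^ 2 *
      (Φ (hA.eigenvalues i) (hB.eigenvalues j) * Ψ (hA.eigenvalues i) (hB.eigenvalues j)) := by
    rw [hP, hQ, of_apply, of_apply, star_smul, smul_mul_smul_comm, Complex.smul_re,
      Complex.star_def, Complex.mul_conj, Complex.ofReal_re, Complex.normSq_eq_norm_sq,
      star_trivial, smul_eq_mul, mul_comm]
  rw [conj, ntr_mul_comm, ← Matrix.mul_assoc, hU, Matrix.one_mul, ntr_apply,
    Fintype.sum_prod_type]
  simp only [Matrix.trace, diag_apply, mul_apply, conjTranspose_apply, Complex.re_sum, entry,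
    Finset.mul_sum, mul_assoc]

theorem hsNormSq_doubleCfc (hA : A.IsHermitian) (hB : B.IsHermitian) (Φ : ℝ → ℝ → ℝ) :
    hsNormSq (doubleCfc hA hB Φ) =
      ∑ p : ι × ι, overlap hA hB p * Φ (hA.eigenvalues p.1) (hB.eigenvalues p.2) ^ 2 := by
  simp only [hsNormSq_eq_ntr, ntr_doubleCfc_mul_conjTranspose, sq]

theorem ntr_doubleCfc (hA : A.IsHermitian) (hB : B.IsHermitian) (Φ : ℝ → ℝ → ℝ) :
    ntr (doubleCfc hA hB Φ) =
      ∑ p : ι × ι, overlap hA hB p * Φ (hA.eigenvalues p.1) (hB.eigenvalues p.2) := by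
  simpa [doubleCfc_one] using ntr_doubleCfc_mul_conjTranspose hA hB Φ fun _ _ => 1

theorem sum_overlap [Nonempty ι] (hA : A.IsHermitian) (hB : B.IsHermitian) :
    ∑ p, overlap hA hB p = 1 := by
  simpa [doubleCfc_one, ntr_one] using (ntr_doubleCfc hA hB fun _ _ => 1).symm

theorem sub_eq_doubleCfc (hA : A.IsHermitian) (hB : B.IsHermitian) :
    A - B = doubleCfc hA hB fun x y => x - y := by
  rw [doubleCfc_sub hA hB (fun x _ => x) (fun _ y => y), doubleCfc_left hA hB fun x => x,
    doubleCfc_right hA hB fun x => x, cfc_id' ℝ A hA.isSelfAdjoint, cfc_id' ℝ B hB.isSelfAdjoint]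

theorem cfc_sub_cfc_eq_doubleCfc (hA : A.IsHermitian) (hB : B.IsHermitian) (f : ℝ → ℝ) :
    cfc f A - cfc f B = doubleCfc hA hB fun x y => f x - f y := by
  rw [doubleCfc_sub hA hB (fun x _ => f x) (fun _ y => f y), doubleCfc_left, doubleCfc_right]

theorem sub_mul_cfc_eq_doubleCfc (hA : A.IsHermitian) (hB : B.IsHermitian) (g : ℝ → ℝ) :
    (A - B) * cfc g B = doubleCfc hA hB fun x y => (x - y) * g y := by
  have B_mul : B * cfc g B = cfc (fun y => y * g y) B := by
    rw [cfc_mul (fun y => y) g B (continuousOn_real_spectrum B _)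
      (continuousOn_real_spectrum B _), cfc_id' ℝ B hB.isSelfAdjoint]
  simp only [sub_mul, doubleCfc_sub hA hB (fun x y => x * g y) (fun _ y => y * g y)]
  rw [doubleCfc_mul hA hB (fun x => x) g, doubleCfc_right hA hB fun y => y * g y,
    cfc_id' ℝ A hA.isSelfAdjoint, B_mul]

theorem mul_sub_sub_mul_eq_doubleCfc (hA : A.IsHermitian) (hB : B.IsHermitian) :
    A * (A - B) - (A - B) * B = doubleCfc hA hB fun x y => (x - y) ^ 2 := by
  have A_mul : A * A = doubleCfc hA hB fun x _ => x ^ 2 := by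
    rw [doubleCfc_left hA hB fun x => x ^ 2, cfc_pow_id A 2 (ha := hA.isSelfAdjoint), sq]
  have A_mul_B : A * B = doubleCfc hA hB fun x y => x * y := by
    rw [doubleCfc_mul hA hB (fun x => x) fun y => y, cfc_id' ℝ A hA.isSelfAdjoint,
      cfc_id' ℝ B hB.isSelfAdjoint]
  have sub_mul : (A - B) * B = doubleCfc hA hB fun x y => (x - y) * y := by
    rw [← sub_mul_cfc_eq_doubleCfc hA hB fun y => y, cfc_id' ℝ B hB.isSelfAdjoint]
  rw [Matrix.mul_sub, A_mul, A_mul_B, sub_mul, ← doubleCfc_sub, ← doubleCfc_sub]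
  congr! 3
  ring

theorem abs_ntr_cfc_sub_ntr_cfc_le [Nonempty ι] (hA : A.IsHermitian) (hB : B.IsHermitian)
    {f : ℝ → ℝ} {K : ℝ≥0} (hf : LipschitzWith K f) :
    |ntr (cfc f A) - ntr (cfc f B)| ≤ K * √(hsNormSq (A - B)) := by
  have jensen : (∑ p, overlap hA hB p * |hA.eigenvalues p.1 - hB.eigenvalues p.2|) ^ 2 ≤
      hsNormSq (A - B) := by
    rw [sub_eq_doubleCfc hA hB, hsNormSq_doubleCfc,
      ← one_mul (∑ p, overlap hA hB p * _ ^ 2), ← sum_overlap hA hB]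
    refine Finset.sum_sq_le_sum_mul_sum_of_sq_le_mul _ (fun p _ => overlap_nonneg hA hB p)
      (fun p _ => mul_nonneg (overlap_nonneg hA hB p) (sq_nonneg _)) fun p _ => le_of_eq ?_
    rw [mul_pow, sq_abs]
    ring
  rw [← map_sub, cfc_sub_cfc_eq_doubleCfc hA hB, ntr_doubleCfc]
  calc |∑ p, overlap hA hB p * (f (hA.eigenvalues p.1) - f (hB.eigenvalues p.2))|
      ≤ ∑ p, overlap hA hB p * (K * |hA.eigenvalues p.1 - hB.eigenvalues p.2|) := by
        refine (Finset.abs_sum_le_sum_abs _ _).trans (Finset.sum_le_sum fun p _ => ?_)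
        rw [abs_mul, abs_of_nonneg (overlap_nonneg hA hB p)]
        exact mul_le_mul_of_nonneg_left (hf.dist_le_mul _ _) (overlap_nonneg hA hB p)
    _ = K * ∑ p, overlap hA hB p * |hA.eigenvalues p.1 - hB.eigenvalues p.2| := by
        rw [Finset.mul_sum]
        exact Finset.sum_congr rfl fun p _ => mul_left_comm _ _ _
    _ ≤ K * √(hsNormSq (A - B)) := by
        gcongr
        exact Real.le_sqrt_of_sq_le jensen

theorem hsNormSq_cfc_sub_cfc_le (hA : A.IsHermitian) (hB : B.IsHermitian) {f : ℝ → ℝ} {K : ℝ≥0}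
    (hf : LipschitzWith K f) : hsNormSq (cfc f A - cfc f B) ≤ K ^ 2 * hsNormSq (A - B) := by
  rw [cfc_sub_cfc_eq_doubleCfc hA hB, sub_eq_doubleCfc hA hB, hsNormSq_doubleCfc,
    hsNormSq_doubleCfc, Finset.mul_sum]
  refine Finset.sum_le_sum fun p _ => ?_
  rw [mul_left_comm, ← mul_pow]
  refine mul_le_mul_of_nonneg_left (sq_le_sq.2 ?_) (overlap_nonneg hA hB p)
  rw [abs_mul, NNReal.abs_eq]
  exact hf.dist_le_mul _ _

theorem abs_ntr_sub_mul_cfc_sub_cfc_sub_le (hA : A.IsHermitian) (hB : B.IsHermitian)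
    {f f' : ℝ → ℝ} {K c : ℝ} (hc : 0 < c)
    (hf : ∀ x y, |f x - f y - f' y * (x - y)| ≤ K * (x - y) ^ 2) :
    |ntr ((A - B) * (cfc f A - cfc f B)) - ntr ((A - B) * ((A - B) * cfc f' B))| ≤
      K / 2 * (c * hsNormSq (A - B) + c⁻¹ * hsNormSq (A * (A - B) - (A - B) * B)) := by
  have hAB : (A - B)ᴴ = A - B := (hA.sub hB).eq
  have remainder (x y : ℝ) : |(x - y) * (f x - f y - f' y * (x - y))| ≤
      K / 2 * (c * (x - y) ^ 2 + c⁻¹ * ((x - y) ^ 2) ^ 2) := by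
    have am_gm : |x - y| ≤ (c + c⁻¹ * (x - y) ^ 2) / 2 := by
      rw [← sq_abs (x - y), ← sub_nonneg,
        show (c + c⁻¹ * |x - y| ^ 2) / 2 - |x - y| = c⁻¹ * (c - |x - y|) ^ 2 / 2 by field]
      positivity
    rw [abs_mul]
    calc |x - y| * |f x - f y - f' y * (x - y)|
        ≤ (c + c⁻¹ * (x - y) ^ 2) / 2 * (K * (x - y) ^ 2) := by gcongr; exact hf x y
      _ = K / 2 * (c * (x - y) ^ 2 + c⁻¹ * ((x - y) ^ 2) ^ 2) := by ring
  have first_order : ntr ((A - B) * (cfc f A - cfc f B)) - ntr ((A - B) * ((A - B) * cfc f' B)) =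
      ∑ p, overlap hA hB p * ((hA.eigenvalues p.1 - hB.eigenvalues p.2) *
        (f (hA.eigenvalues p.1) - f (hB.eigenvalues p.2) -
          f' (hB.eigenvalues p.2) * (hA.eigenvalues p.1 - hB.eigenvalues p.2))) := by
    have h := ntr_doubleCfc_mul_conjTranspose hA hB
      (fun x y => f x - f y - (x - y) * f' y) fun x y => x - y
    rw [doubleCfc_sub hA hB (fun x y => f x - f y), ← cfc_sub_cfc_eq_doubleCfc,
      ← sub_mul_cfc_eq_doubleCfc, ← sub_eq_doubleCfc, hAB, ntr_mul_comm, Matrix.mul_sub,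
      map_sub] at h
    rw [h]
    exact Finset.sum_congr rfl fun p _ => by ring
  rw [first_order, mul_sub_sub_mul_eq_doubleCfc hA hB]
  conv_rhs => rw [sub_eq_doubleCfc hA hB]
  rw [hsNormSq_doubleCfc, hsNormSq_doubleCfc, Finset.mul_sum, Finset.mul_sum,
    ← Finset.sum_add_distrib, Finset.mul_sum]
  refine (Finset.abs_sum_le_sum_abs _ _).trans (Finset.sum_le_sum fun p _ => ?_)
  rw [abs_mul, abs_of_nonneg (overlap_nonneg hA hB p)]
  refine (mul_le_mul_of_nonneg_left (remainder _ _) (overlap_nonneg hA hB p)).trans_eq ?_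
  ring

end DoubleOperatorIntegral

section SpectralMeasure

variable {ι : Type*} [Fintype ι] [DecidableEq ι] {A : Matrix ι ι ℂ}

theorem integral_spectralMeasure (hA : A.IsHermitian) (f : ℝ → ℝ) :
    ∫ x, f x ∂spectralMeasure hA = ntr (cfc f A) := by
  rw [spectralMeasure, integral_smul_measure,
    integral_finsetSum_measure fun i _ => integrable_dirac (by simp), ntr_cfc_eq_sum hA]
  simp

variable [Nonempty ι]

theorem isProbabilityMeasure_spectralMeasure (hA : A.IsHermitian) :
    IsProbabilityMeasure (spectralMeasure hA) := by
  constructor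
  simp only [spectralMeasure, Measure.smul_apply, Measure.coe_finsetSum, Finset.sum_apply,
    measure_univ, Finset.sum_const, Finset.card_univ, nsmul_eq_mul, mul_one, smul_eq_mul]
  exact ENNReal.inv_mul_cancel (by simp) (by simp)

theorem integrable_spectralMeasure (hA : A.IsHermitian) (f : ℝ → ℝ) :
    Integrable f (spectralMeasure hA) :=
  (integrable_finsetSum_measure.2 fun _ _ => integrable_dirac (by simp)).smul_measure (by simp)

end SpectralMeasure

section LocalSpinFamily

open Matrix

variable {κ ι : Type*} [Fintype κ]

/-- The operator with coefficients `x` in the family `b`, scaled to have unit expected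
Hilbert–Schmidt norm when the coefficients have unit variance. -/
def spinSum (b : κ → Matrix ι ι ℂ) : (κ → ℝ) →ₗ[ℝ] Matrix ι ι ℂ :=
  (√(Fintype.card κ))⁻¹ • Fintype.linearCombination ℝ b

theorem spinSum_apply (b : κ → Matrix ι ι ℂ) (x : κ → ℝ) :
    spinSum b x = (√(Fintype.card κ))⁻¹ • ∑ k, x k • b k := rfl

theorem continuous_spinSum (b : κ → Matrix ι ι ℂ) : Continuous (spinSum b) :=
  (spinSum b).continuous_of_finiteDimensional

theorem sq_inv_sqrt_card : ((√(Fintype.card κ))⁻¹) ^ 2 = (Fintype.card κ : ℝ)⁻¹ := by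
  rw [inv_pow, Real.sq_sqrt (Nat.cast_nonneg _)]

theorem spinSum_sub_spinSum_update [DecidableEq κ] (b : κ → Matrix ι ι ℂ) (x : κ → ℝ) (k : κ) :
    spinSum b x - spinSum b (Function.update x k 0) = ((√(Fintype.card κ))⁻¹ * x k) • b k := by
  rw [← map_sub, spinSum_apply, Finset.sum_eq_single k _ (by simp), mul_smul]
  · simp
  · intro l _ hl
    simp [hl]

variable [Fintype ι]

open scoped Classical in
/-- The indices of the matrices of the family `b` that do not commute with `b k`. -/
def noncommuting (b : κ → Matrix ι ι ℂ) (k : κ) : Finset κ := {l | ¬Commute (b l) (b k)}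

/-- A finite family of Hermitian involutions that are orthogonal for the trace inner product and
of which at most `D` fail to commute with any given one. The interaction terms of a spin system
with local interactions are the model case; locality enters only through `D`. -/
structure IsLocalSpinFamily [DecidableEq ι] (D : ℕ) (b : κ → Matrix ι ι ℂ) : Prop where
  isHermitian : ∀ k, (b k).IsHermitian
  mul_self : ∀ k, b k * b k = 1
  ntr_mul_of_ne : ∀ k l, k ≠ l → ntr (b k * b l) = 0
  card_noncommuting_le : ∀ k, (noncommuting b k).card ≤ D

namespace IsLocalSpinFamily

variable [DecidableEq ι] {b : κ → Matrix ι ι ℂ} {D : ℕ}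

theorem isHermitian_spinSum (hb : IsLocalSpinFamily D b) (x : κ → ℝ) :
    (spinSum b x).IsHermitian := by
  simp only [Matrix.IsHermitian, spinSum_apply, conjTranspose_smul, conjTranspose_sum,
    (hb.isHermitian _).eq, star_trivial]

theorem conjTranspose_mul_self (hb : IsLocalSpinFamily D b) (k : κ) : (b k)ᴴ * b k = 1 := by
  rw [(hb.isHermitian k).eq, hb.mul_self]

variable [Nonempty ι]

theorem hsNormSq_apply (hb : IsLocalSpinFamily D b) (k : κ) : hsNormSq (b k) = 1 :=
  hsNormSq_of_conjTranspose_mul_self (hb.conjTranspose_mul_self k)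

theorem hsNormSq_spinSum (hb : IsLocalSpinFamily D b) (x : κ → ℝ) :
    hsNormSq (spinSum b x) = (Fintype.card κ : ℝ)⁻¹ * ∑ k, x k ^ 2 := by
  have hH : (∑ k, x k • b k)ᴴ = ∑ k, x k • b k := by
    simp only [conjTranspose_smul, conjTranspose_sum, (hb.isHermitian _).eq, star_trivial]
  rw [spinSum_apply, hsNormSq_smul, sq_inv_sqrt_card, hsNormSq_eq_ntr, hH, Finset.sum_mul_sum,
    map_sum]
  congr 1
  refine Finset.sum_congr rfl fun k _ => ?_
  simp only [map_sum, smul_mul_smul_comm, map_smul, smul_eq_mul]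
  rw [Finset.sum_eq_single k _ (by simp), hb.mul_self, ntr_one, mul_one, sq]
  intro l _ hl
  rw [hb.ntr_mul_of_ne k l hl.symm, mul_zero]

theorem hsNormSq_commutator_le (hb : IsLocalSpinFamily D b) (k l : κ) :
    hsNormSq (b l * b k - b k * b l) ≤ 4 := by
  refine (hsNormSq_sub_le _ _).trans_eq ?_
  rw [hsNormSq_mul_of_conjTranspose_mul_self (hb.conjTranspose_mul_self _),
    hsNormSq_mul_of_conjTranspose_mul_self (hb.conjTranspose_mul_self _), hb.hsNormSq_apply,
    hb.hsNormSq_apply]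
  norm_num

theorem hsNormSq_spinSum_commutator_le (hb : IsLocalSpinFamily D b) (x : κ → ℝ) (k : κ) :
    hsNormSq (spinSum b x * b k - b k * spinSum b x) ≤
      (Fintype.card κ : ℝ)⁻¹ * (4 * D * ∑ l ∈ noncommuting b k, x l ^ 2) := by
  have commutator : spinSum b x * b k - b k * spinSum b x = (√(Fintype.card κ))⁻¹ •
      ∑ l ∈ noncommuting b k, x l • (b l * b k - b k * b l) := by
    rw [spinSum_apply, smul_mul_assoc, mul_smul_comm, ← smul_sub, Finset.sum_mul, Finset.mul_sum,
      ← Finset.sum_sub_distrib, Finset.sum_subset (Finset.subset_univ (noncommuting b k))]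
    · simp only [smul_mul_assoc, mul_smul_comm, smul_sub]
    · intro l _ hl
      have hl : Commute (b l) (b k) := by simpa [noncommuting] using hl
      rw [hl.eq, sub_self, smul_zero]
  rw [commutator, hsNormSq_smul, sq_inv_sqrt_card]
  gcongr
  calc hsNormSq (∑ l ∈ noncommuting b k, x l • (b l * b k - b k * b l))
      ≤ (noncommuting b k).card *
          ∑ l ∈ noncommuting b k, hsNormSq (x l • (b l * b k - b k * b l)) := hsNormSq_sum_le _ _
    _ ≤ D * ∑ l ∈ noncommuting b k, x l ^ 2 * 4 := by
        gcongr with l _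
        · exact Finset.sum_nonneg fun _ _ => hsNormSq_nonneg _
        · exact hb.card_noncommuting_le k
        · rw [hsNormSq_smul]
          gcongr
          exact hb.hsNormSq_commutator_le k l
    _ = 4 * D * ∑ l ∈ noncommuting b k, x l ^ 2 := by rw [← Finset.sum_mul]; ring

theorem hsNormSq_second_difference_le [DecidableEq κ] (hb : IsLocalSpinFamily D b) (x : κ → ℝ)
    (k : κ) {A B : Matrix ι ι ℂ} (hA : A = spinSum b x)
    (hB : B = spinSum b (Function.update x k 0)) :
    hsNormSq (A * (A - B) - (A - B) * B) ≤ ((Fintype.card κ : ℝ)⁻¹) ^ 2 *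
      (4 * D * ∑ l ∈ noncommuting b k, (x k ^ 4 + x l ^ 4) + 2 * x k ^ 4) := by
  set N : ℝ := (Fintype.card κ : ℝ)⁻¹
  set d := (√(Fintype.card κ))⁻¹ * x k with hd
  have sq_d : d ^ 2 = N * x k ^ 2 := by rw [hd, mul_pow, sq_inv_sqrt_card]
  have hAB : A - B = d • b k := by rw [hA, hB, spinSum_sub_spinSum_update]
  have expand : A * (A - B) - (A - B) * B = d • (B * b k - b k * B) + d ^ 2 • 1 := by
    rw [hAB, eq_add_of_sub_eq hAB, Matrix.add_mul, smul_mul_assoc, mul_smul_comm, smul_mul_assoc,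
      mul_smul_comm, hb.mul_self, smul_smul, smul_sub, ← sq]
    abel
  have commutator_le : hsNormSq (B * b k - b k * B) ≤
      N * (4 * D * ∑ l ∈ noncommuting b k, x l ^ 2) := by
    rw [hB]
    refine (hb.hsNormSq_spinSum_commutator_le _ k).trans_eq ?_
    congr 2
    refine Finset.sum_congr rfl fun l hl => ?_
    rw [Function.update_of_ne fun h => by simp [noncommuting, h] at hl]
  calc hsNormSq (A * (A - B) - (A - B) * B)
      ≤ 2 * (d ^ 2 * hsNormSq (B * b k - b k * B) + (d ^ 2) ^ 2 * hsNormSq (1 : Matrix ι ι ℂ)) := by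
        rw [expand, ← hsNormSq_smul, ← hsNormSq_smul]
        exact hsNormSq_add_le _ _
    _ ≤ 2 * (N * x k ^ 2 * (N * (4 * D * ∑ l ∈ noncommuting b k, x l ^ 2)) +
          (N * x k ^ 2) ^ 2 * 1) := by
        rw [sq_d, hsNormSq_of_conjTranspose_mul_self (U := 1) (by simp)]
        gcongr 2 * (?_ * ?_ + _)
    _ = N ^ 2 * (4 * D * ∑ l ∈ noncommuting b k, 2 * (x k ^ 2 * x l ^ 2) + 2 * x k ^ 4) := by
        rw [← Finset.mul_sum, ← Finset.mul_sum]
        ring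
    _ ≤ N ^ 2 * (4 * D * ∑ l ∈ noncommuting b k, (x k ^ 4 + x l ^ 4) + 2 * x k ^ 4) := by
        gcongr ?_ * (4 * D * ?_ + _)
        refine Finset.sum_le_sum fun l _ => ?_
        linarith [two_mul_le_add_sq (x k ^ 2) (x l ^ 2)]

end IsLocalSpinFamily

end LocalSpinFamily

section PauliChain

open Matrix

variable {n : ℕ}

theorem trace_tensorProd (A : Fin n → Matrix (Fin 2) (Fin 2) ℂ) :
    (tensorProd A).trace = ∏ k, (A k).trace := by
  simp only [tensorProd, trace, diag, of_apply, Finset.prod_univ_sum, Fintype.piFinset_univ]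

theorem tensorProd_one : tensorProd (fun _ : Fin n => (1 : Matrix (Fin 2) (Fin 2) ℂ)) = 1 := by
  ext s t
  simp [tensorProd, one_apply, Finset.prod_ite_zero, funext_iff]

theorem pauli_mul_self (a : Fin 3) : pauli a * pauli a = 1 := by
  fin_cases a <;> ext i j <;> fin_cases i <;> fin_cases j <;> simp [pauli]

theorem trace_pauli (a : Fin 3) : (pauli a).trace = 0 := by
  fin_cases a <;> simp [pauli, trace]

theorem trace_pauli_mul_pauli {a b : Fin 3} (h : a ≠ b) : (pauli a * pauli b).trace = 0 := by
  fin_cases a <;> fin_cases b <;> simp_all [pauli, trace]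

theorem sitePauli_mul_self (a : Fin 3) (j : Fin n) : sitePauli a j * sitePauli a j = 1 := by
  rw [sitePauli, tensorProd_mul, ← tensorProd_one]
  congr 1
  funext i
  obtain rfl | h := eq_or_ne i j
  · simp [pauli_mul_self]
  · simp [h]

theorem finRotate_finRotate_ne_self (hn : 3 ≤ n) (j : Fin n) :
    finRotate n (finRotate n j) ≠ j := by
  obtain ⟨m, rfl⟩ := Nat.exists_eq_add_of_le' hn
  rw [finRotate_apply, finRotate_apply, add_assoc, Ne, add_eq_left]
  simp [Fin.ext_iff, Fin.val_add, Nat.mod_eq_of_lt (by lia : 2 < m + 3)]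

/-- The interaction term `σ⁽ᵃ⁾ⱼ σ⁽ᵇ⁾ⱼ₊₁` for `k = (a, b, j)`. -/
def bond (k : Fin 3 × Fin 3 × Fin n) : Matrix (Fin n → Fin 2) (Fin n → Fin 2) ℂ :=
  sitePauli k.1 k.2.2 * sitePauli k.2.1 (finRotate n k.2.2)

/-- The factor of the tensor product `bond k` at the site `i`. -/
def bondFactor (k : Fin 3 × Fin 3 × Fin n) (i : Fin n) : Matrix (Fin 2) (Fin 2) ℂ :=
  Function.update (fun _ => 1 : Fin n → Matrix (Fin 2) (Fin 2) ℂ) k.2.2 (pauli k.1) i *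
    Function.update (fun _ => 1 : Fin n → Matrix (Fin 2) (Fin 2) ℂ) (finRotate n k.2.2)
      (pauli k.2.1) i

theorem bond_eq_tensorProd (k : Fin 3 × Fin 3 × Fin n) : bond k = tensorProd (bondFactor k) :=
  tensorProd_mul _ _

theorem bondFactor_left (hn : 2 ≤ n) (k : Fin 3 × Fin 3 × Fin n) :
    bondFactor k k.2.2 = pauli k.1 := by
  rw [bondFactor, Function.update_self, Function.update_of_ne (finRotate_ne_self hn _),
    Matrix.mul_one]

theorem bondFactor_right (hn : 2 ≤ n) (k : Fin 3 × Fin 3 × Fin n) :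
    bondFactor k (finRotate n k.2.2) = pauli k.2.1 := by
  rw [bondFactor, Function.update_self, Function.update_of_ne (finRotate_ne_self hn _).symm,
    Matrix.one_mul]

theorem bondFactor_of_ne {k : Fin 3 × Fin 3 × Fin n} {i : Fin n} (hl : i ≠ k.2.2)
    (hr : i ≠ finRotate n k.2.2) : bondFactor k i = 1 := by
  rw [bondFactor, Function.update_of_ne hl, Function.update_of_ne hr, Matrix.one_mul]

theorem bond_isHermitian (hn : 2 ≤ n) (k : Fin 3 × Fin 3 × Fin n) : (bond k).IsHermitian := by
  rw [bond, Matrix.IsHermitian, conjTranspose_mul, (sitePauli_isHermitian _ _).eq,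
    (sitePauli_isHermitian _ _).eq]
  exact (sitePauli_commute _ _ (finRotate_ne_self hn k.2.2)).eq.symm

theorem bond_mul_self (hn : 2 ≤ n) (k : Fin 3 × Fin 3 × Fin n) : bond k * bond k = 1 := by
  rw [bond, (sitePauli_commute _ _ (finRotate_ne_self hn k.2.2)).symm.mul_mul_mul_comm,
    sitePauli_mul_self, sitePauli_mul_self, Matrix.one_mul]

/-- For `n = 2` this fails: `bond (a, b, 0) = bond (b, a, 1)`. -/
theorem trace_bond_mul_bond (hn : 3 ≤ n) {k l : Fin 3 × Fin 3 × Fin n} (h : k ≠ l) :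
    (bond k * bond l).trace = 0 := by
  have hn' : 2 ≤ n := by lia
  rw [bond_eq_tensorProd, bond_eq_tensorProd, tensorProd_mul, trace_tensorProd,
    Finset.prod_eq_zero_iff]
  by_cases site : k.2.2 = l.2.2
  · by_cases left : k.1 = l.1
    · have right : k.2.1 ≠ l.2.1 := fun right => h (Prod.ext left (Prod.ext right site))
      refine ⟨finRotate n k.2.2, Finset.mem_univ _, ?_⟩
      rw [bondFactor_right hn', site, bondFactor_right hn', trace_pauli_mul_pauli right]
    · refine ⟨k.2.2, Finset.mem_univ _, ?_⟩
      rw [bondFactor_left hn', site, bondFactor_left hn', trace_pauli_mul_pauli left]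
  · by_cases next : k.2.2 = finRotate n l.2.2
    · refine ⟨finRotate n k.2.2, Finset.mem_univ _, ?_⟩
      rw [bondFactor_right hn', bondFactor_of_ne (next ▸ finRotate_finRotate_ne_self hn _)
        ((finRotate n).injective.ne site), Matrix.mul_one, trace_pauli]
    · refine ⟨k.2.2, Finset.mem_univ _, ?_⟩
      rw [bondFactor_left hn', bondFactor_of_ne site next, Matrix.mul_one, trace_pauli]

theorem card_noncommuting_bond_le (k : Fin 3 × Fin 3 × Fin n) :
    (noncommuting bond k).card ≤ 27 := by
  let nearby : Finset (Fin n) := {k.2.2, finRotate n k.2.2, (finRotate n).symm k.2.2}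
  have subset : noncommuting bond k ⊆ Finset.univ ×ˢ Finset.univ ×ˢ nearby := by
    intro l hl
    contrapose! hl
    simp only [nearby, Finset.mem_product, Finset.mem_univ, true_and, Finset.mem_insert,
      Finset.mem_singleton, not_or, Equiv.eq_symm_apply] at hl
    obtain ⟨same, left, right⟩ := hl
    have commute : Commute (bond l) (bond k) :=
      ((sitePauli_commute _ _ same).mul_left (sitePauli_commute _ _ right)).mul_right
        ((sitePauli_commute _ _ left).mul_left
          (sitePauli_commute _ _ ((finRotate n).injective.ne same)))
    simpa only [noncommuting, Finset.mem_filter_univ, not_not] using commute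
  calc (noncommuting bond k).card
      ≤ (Finset.univ ×ˢ Finset.univ ×ˢ nearby : Finset (Fin 3 × Fin 3 × Fin n)).card :=
        Finset.card_le_card subset
    _ = 3 * (3 * nearby.card) := by simp
    _ ≤ 3 * (3 * 3) := by gcongr; exact Finset.card_le_three

theorem isLocalSpinFamily_bond (hn : 3 ≤ n) :
    IsLocalSpinFamily 27 (bond : Fin 3 × Fin 3 × Fin n → _) where
  isHermitian := bond_isHermitian (by lia)
  mul_self := bond_mul_self (by lia)
  ntr_mul_of_ne k l h := by rw [ntr_apply, trace_bond_mul_bond hn h, Complex.zero_re, mul_zero]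
  card_noncommuting_le := card_noncommuting_bond_le

theorem card_bond_index (n : ℕ) : (Fintype.card (Fin 3 × Fin 3 × Fin n) : ℝ) = 9 * n := by
  simp only [Fintype.card_prod, Fintype.card_fin]
  push_cast
  ring

theorem hamiltonian_eq_spinSum (x : Fin 3 × Fin 3 × Fin n → ℝ) :
    hamiltonian (fun a b j => x (a, b, j)) = spinSum bond x := by
  simp only [spinSum_apply, card_bond_index, hamiltonian, one_div, Complex.coe_smul,
    Fintype.sum_prod_type]
  rw [Finset.sum_comm]
  congr 1
  exact Finset.sum_congr rfl fun _ _ => Finset.sum_comm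

end PauliChain

section SteinEquation

/-- The unnormalised standard Gaussian density. -/
def gaussWeight (x : ℝ) : ℝ := Real.exp (-x ^ 2 / 2)

theorem gaussWeight_pos (x : ℝ) : 0 < gaussWeight x := Real.exp_pos _

theorem gaussWeight_neg (x : ℝ) : gaussWeight (-x) = gaussWeight x := by simp [gaussWeight]

theorem continuous_gaussWeight : Continuous gaussWeight := by unfold gaussWeight; fun_prop

theorem gaussWeight_eq (x : ℝ) : gaussWeight x = Real.exp (-(1 / 2) * x ^ 2) := by
  rw [gaussWeight]
  congr 1
  ring

theorem integrable_gaussWeight : Integrable gaussWeight := by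
  simpa only [← gaussWeight_eq] using integrable_exp_neg_mul_sq (b := 1 / 2) (by norm_num)

theorem integrable_id_mul_gaussWeight : Integrable fun x => x * gaussWeight x := by
  simpa only [← gaussWeight_eq] using integrable_mul_exp_neg_mul_sq (b := 1 / 2) (by norm_num)

theorem integral_gaussWeight : ∫ x, gaussWeight x = √(2 * Real.pi) := by
  simp only [gaussWeight_eq, integral_gaussian]
  congr 1
  ring

theorem hasDerivAt_gaussWeight (x : ℝ) : HasDerivAt gaussWeight (-x * gaussWeight x) x := by
  have h : HasDerivAt (fun y : ℝ => -y ^ 2 / 2) (-x) x :=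
    ((hasDerivAt_pow 2 x).fun_neg.div_const 2).congr_deriv (by simp; ring)
  exact h.exp.congr_deriv (mul_comm _ _)

theorem tendsto_gaussWeight_atTop : Tendsto gaussWeight atTop (𝓝 0) := by
  refine Real.tendsto_exp_atBot.comp ((tendsto_div_const_atBot_of_pos two_pos).2 ?_)
  exact tendsto_neg_atTop_atBot.comp (tendsto_pow_atTop two_ne_zero)

theorem integrable_mul_gaussWeight_of_abs_le {h : ℝ → ℝ} (hc : Continuous h) {b : ℝ}
    (hb : ∀ x, |h x| ≤ b) : Integrable fun x => h x * gaussWeight x :=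
  integrable_gaussWeight.bdd_mul hc.aestronglyMeasurable (ae_of_all _ hb)

theorem integral_gaussianReal_eq_integral_mul_gaussWeight (h : ℝ → ℝ) :
    ∫ x, h x ∂gaussianReal 0 1 = (√(2 * Real.pi))⁻¹ * ∫ x, h x * gaussWeight x := by
  rw [integral_gaussianReal_eq_integral_smul one_ne_zero, ← integral_const_mul]
  congr 1 with x
  simp only [gaussianPDFReal, gaussWeight, smul_eq_mul, NNReal.coe_one, mul_one, sub_zero]
  ring

/-- The integral of `h` over `(x, ∞)` against the Gaussian density, relative to the density at
`x`. It solves `f' = x f - h`, which up to sign is Stein's equation. -/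
def gaussTail (h : ℝ → ℝ) (x : ℝ) : ℝ :=
  (gaussWeight x)⁻¹ * ∫ y in Set.Ioi x, h y * gaussWeight y

theorem gaussTail_add {g h : ℝ → ℝ} (hg : Integrable fun x => g x * gaussWeight x)
    (hh : Integrable fun x => h x * gaussWeight x) (x : ℝ) :
    gaussTail (fun y => g y + h y) x = gaussTail g x + gaussTail h x := by
  simp only [gaussTail, add_mul]
  rw [integral_add hg.integrableOn hh.integrableOn, mul_add]

theorem gaussTail_const_mul (c : ℝ) (h : ℝ → ℝ) (x : ℝ) :
    gaussTail (fun y => c * h y) x = c * gaussTail h x := by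
  simp only [gaussTail, mul_assoc]
  rw [integral_const_mul, mul_left_comm]

theorem abs_gaussTail_le {g h : ℝ → ℝ} (hg : Integrable fun x => g x * gaussWeight x) {x : ℝ}
    (hle : ∀ y, x < y → |h y| ≤ g y) : |gaussTail h x| ≤ gaussTail g x := by
  have hx := inv_pos.2 (gaussWeight_pos x)
  rw [gaussTail, gaussTail, abs_mul, abs_of_pos hx]
  refine mul_le_mul_of_nonneg_left ?_ hx.le
  refine norm_integral_le_of_norm_le (f := fun y => h y * gaussWeight y) hg.integrableOn ?_
  filter_upwards [ae_restrict_mem measurableSet_Ioi] with y hy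
  rw [norm_mul, Real.norm_of_nonneg (gaussWeight_pos y).le]
  exact mul_le_mul_of_nonneg_right (hle y hy) (gaussWeight_pos y).le

theorem gaussTail_eq_of_hasDerivAt {f h : ℝ → ℝ}
    (hf : ∀ y, HasDerivAt (fun y => -(f y * gaussWeight y)) (h y * gaussWeight y) y)
    (hh : Integrable fun x => h x * gaussWeight x)
    (h0 : Tendsto (fun y => f y * gaussWeight y) atTop (𝓝 0)) (x : ℝ) : gaussTail h x = f x := by
  have h0 := neg_zero (G := ℝ) ▸ h0.neg
  rw [gaussTail, integral_Ioi_of_hasDerivAt_of_tendsto' (fun y _ => hf y) hh.integrableOn h0,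
    zero_sub, neg_neg, mul_comm, mul_inv_cancel_right₀ (gaussWeight_pos x).ne']

theorem gaussTail_id (x : ℝ) : gaussTail (fun y => y) x = 1 :=
  gaussTail_eq_of_hasDerivAt (f := fun _ => 1)
    (fun y => by simpa using (hasDerivAt_gaussWeight y).fun_neg)
    integrable_id_mul_gaussWeight (by simpa using tendsto_gaussWeight_atTop) x

theorem hasDerivAt_gaussTail {h : ℝ → ℝ} (hc : Continuous h)
    (hi : Integrable fun x => h x * gaussWeight x) (x : ℝ) :
    HasDerivAt (gaussTail h) (x * gaussTail h x - h x) x := by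
  have tail : HasDerivAt (fun x => ∫ y in Set.Ioi x, h y * gaussWeight y)
      (-(h x * gaussWeight x)) x := by
    have split (z : ℝ) : ∫ y in Set.Ioi z, h y * gaussWeight y =
        (∫ y in Set.Ioi 0, h y * gaussWeight y) - ∫ y in (0)..z, h y * gaussWeight y := by
      rw [← intervalIntegral.integral_Ioi_sub_Ioi' hi.integrableOn hi.integrableOn, sub_sub_cancel]
    have hcw : Continuous fun y => h y * gaussWeight y := hc.mul continuous_gaussWeight
    rw [funext split]
    exact (intervalIntegral.integral_hasDerivAt_right hi.intervalIntegrable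
      (hcw.stronglyMeasurableAtFilter _ _) hcw.continuousAt).const_sub _
  have hx := (gaussWeight_pos x).ne'
  refine (((hasDerivAt_gaussWeight x).inv hx).mul tail).congr_deriv ?_
  simp only [gaussTail, Pi.inv_apply]
  field_simp
  ring

theorem gaussTail_neg {h : ℝ → ℝ} (hi : Integrable fun x => h x * gaussWeight x)
    (h0 : ∫ x, h x * gaussWeight x = 0) (x : ℝ) :
    gaussTail h (-x) = -gaussTail (fun y => h (-y)) x := by
  have reflect : ∫ y in Set.Ioi x, h (-y) * gaussWeight y =
      ∫ y in Set.Iic (-x), h y * gaussWeight y := by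
    rw [← integral_comp_neg_Ioi]
    simp only [gaussWeight_neg]
  have total := intervalIntegral.integral_Iic_add_Ioi (b := -x) hi.integrableOn hi.integrableOn
  rw [gaussTail, gaussTail, reflect, gaussWeight_neg, ← mul_neg,
    eq_neg_of_add_eq_zero_right (total.trans h0)]

/-- The Mills ratio of the standard Gaussian distribution. -/
def millsRatio (x : ℝ) : ℝ := gaussTail (fun _ => 1) x

theorem gaussTail_const (c x : ℝ) : gaussTail (fun _ => c) x = c * millsRatio x := by
  simpa only [mul_one] using! gaussTail_const_mul c (fun _ => 1) x

theorem mul_millsRatio_le_one {x : ℝ} (hx : 0 ≤ x) : x * millsRatio x ≤ 1 := by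
  rw [← gaussTail_const, ← gaussTail_id x]
  exact (le_abs_self _).trans (abs_gaussTail_le integrable_id_mul_gaussWeight fun y hy => by
    rw [abs_of_nonneg hx]
    exact hy.le)

theorem abs_one_sub_two_div_le_one (y : ℝ) : |1 - 2 / (1 + y ^ 2) ^ 2| ≤ 1 := by
  have : 2 / (1 + y ^ 2) ^ 2 ≤ 2 :=
    div_le_self two_pos.le (one_le_pow₀ (le_add_of_nonneg_right (sq_nonneg y)))
  rw [abs_le]
  constructor <;> linarith [show 0 ≤ 2 / (1 + y ^ 2) ^ 2 by positivity]

theorem gaussTail_one_sub_two_div (x : ℝ) :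
    gaussTail (fun y => 1 - 2 / (1 + y ^ 2) ^ 2) x = x / (1 + x ^ 2) := by
  refine gaussTail_eq_of_hasDerivAt (f := fun y => y / (1 + y ^ 2)) (fun y => ?_)
    (integrable_mul_gaussWeight_of_abs_le ?_ abs_one_sub_two_div_le_one) ?_ x
  · have hy : 1 + y ^ 2 ≠ 0 := by positivity
    have h1 : HasDerivAt (fun y : ℝ => 1 + y ^ 2) (2 * y) y := by
      simpa using (hasDerivAt_pow 2 y).const_add 1
    refine (((hasDerivAt_id y).div h1 hy).mul (hasDerivAt_gaussWeight y)).neg.congr_deriv ?_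
    simp only [id, Pi.div_apply]
    field_simp
    ring
  · exact continuous_const.sub (continuous_const.div (by fun_prop) fun y => by positivity)
  · refine squeeze_zero_norm (fun y => ?_) tendsto_gaussWeight_atTop
    rw [norm_mul, norm_div, Real.norm_of_nonneg (gaussWeight_pos y).le,
      Real.norm_of_nonneg (by positivity : 0 ≤ 1 + y ^ 2), Real.norm_eq_abs]
    refine mul_le_of_le_one_left (gaussWeight_pos y).le ((div_le_one (by positivity)).2 ?_)
    nlinarith [sq_abs y, sq_nonneg (|y| - 1)]

theorem le_mul_millsRatio (x : ℝ) : x ≤ (1 + x ^ 2) * millsRatio x := by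
  have hx : 0 < 1 + x ^ 2 := by positivity
  rw [← div_le_iff₀' hx, ← gaussTail_one_sub_two_div]
  exact (le_abs_self _).trans (abs_gaussTail_le (by simpa using integrable_gaussWeight)
    fun y _ => abs_one_sub_two_div_le_one y)

theorem millsRatio_le_three {x : ℝ} (hx : 0 ≤ x) : millsRatio x ≤ 3 := by
  have translate (y : ℝ) (hy : x < y) :
      1 * gaussWeight y ≤ gaussWeight x * gaussWeight (y - x) := by
    rw [one_mul, gaussWeight, gaussWeight, gaussWeight, ← Real.exp_add, Real.exp_le_exp]
    nlinarith
  have shifted := integrable_gaussWeight.comp_sub_right x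
  calc millsRatio x
      ≤ (gaussWeight x)⁻¹ * ∫ y in Set.Ioi x, gaussWeight x * gaussWeight (y - x) := by
        refine mul_le_mul_of_nonneg_left ?_ (inv_pos.2 (gaussWeight_pos x)).le
        refine setIntegral_mono_on ?_ (shifted.const_mul _).integrableOn measurableSet_Ioi translate
        simpa using integrable_gaussWeight.integrableOn
    _ = ∫ y in Set.Ioi x, gaussWeight (y - x) := by
        rw [integral_const_mul, inv_mul_cancel_left₀ (gaussWeight_pos x).ne']
    _ ≤ ∫ y, gaussWeight (y - x) :=
        setIntegral_le_integral shifted (ae_of_all _ fun y => (gaussWeight_pos _).le)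
    _ = √(2 * Real.pi) := by rw [integral_sub_right_eq_self gaussWeight, integral_gaussWeight]
    _ ≤ 3 := Real.sqrt_le_iff.2 ⟨by norm_num, by linarith [Real.pi_lt_four]⟩

section Bounds

variable {h : ℝ → ℝ} {b x : ℝ}

theorem abs_gaussTail_le_mul_millsRatio (hb : ∀ y, |h y| ≤ b) (x : ℝ) :
    |gaussTail h x| ≤ b * millsRatio x := by
  rw [← gaussTail_const]
  exact abs_gaussTail_le (integrable_gaussWeight.const_mul b) fun y _ => hb y

theorem abs_gaussTail_sub_mul_millsRatio_le (hL : LipschitzWith 1 h)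
    (hi : Integrable fun y => h y * gaussWeight y) (x : ℝ) :
    |gaussTail h x - h x * millsRatio x| ≤ 1 - x * millsRatio x := by
  have sub_const {g : ℝ → ℝ} (hg : Integrable fun y => g y * gaussWeight y) (c : ℝ) :
      gaussTail (fun y => g y - c) x = gaussTail g x - c * millsRatio x := by
    simp only [sub_eq_add_neg]
    rw [gaussTail_add hg (integrable_gaussWeight.const_mul _), gaussTail_const, neg_mul]
  rw [← sub_const hi, ← gaussTail_id x, ← sub_const integrable_id_mul_gaussWeight]
  refine abs_gaussTail_le ?_ fun y hy => ?_
  · simpa only [sub_mul] using!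
      integrable_id_mul_gaussWeight.sub (integrable_gaussWeight.const_mul x)
  · simpa [Real.dist_eq, abs_of_pos (sub_pos.2 hy)] using hL.dist_le_mul y x

theorem abs_one_add_sq_mul_gaussTail_sub_le (hb : ∀ y, |h y| ≤ b) (hL : LipschitzWith 1 h)
    (hx : 0 ≤ x) : |(1 + x ^ 2) * gaussTail h x - x * h x| ≤ 3 * b + 1 := by
  have increment := abs_gaussTail_sub_mul_millsRatio_le hL
    (integrable_mul_gaussWeight_of_abs_le hL.continuous hb) x
  have lower := le_mul_millsRatio x
  have upper := mul_millsRatio_le_one hx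
  have le_three := millsRatio_le_three hx
  calc |(1 + x ^ 2) * gaussTail h x - x * h x|
      = |((1 + x ^ 2) * millsRatio x - x) * h x +
          (1 + x ^ 2) * (gaussTail h x - h x * millsRatio x)| := by
        congr 1
        ring
    _ ≤ ((1 + x ^ 2) * millsRatio x - x) * |h x| +
          (1 + x ^ 2) * |gaussTail h x - h x * millsRatio x| := by
        refine (abs_add_le _ _).trans_eq ?_
        rw [abs_mul, abs_mul, abs_of_nonneg (sub_nonneg.2 lower),
          abs_of_pos (by positivity : 0 < 1 + x ^ 2)]
    _ ≤ ((1 + x ^ 2) * millsRatio x - x) * b + (1 + x ^ 2) * (1 - x * millsRatio x) := by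
        have := sub_nonneg.2 lower
        gcongr
        exact hb x
    _ ≤ 3 * b + 1 := by
        have hb0 : 0 ≤ b := (abs_nonneg _).trans (hb x)
        gcongr
        · nlinarith
        · nlinarith

theorem gaussTail_bounds_of_nonneg (hb : ∀ y, |h y| ≤ b) (hL : LipschitzWith 1 h) (hx : 0 ≤ x) :
    |gaussTail h x| ≤ 3 * b ∧ |x * gaussTail h x| ≤ b ∧
      |(1 + x ^ 2) * gaussTail h x - x * h x| ≤ 3 * b + 1 := by
  have hb0 : 0 ≤ b := (abs_nonneg _).trans (hb x)
  have hle := abs_gaussTail_le_mul_millsRatio hb x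
  refine ⟨?_, ?_, abs_one_add_sq_mul_gaussTail_sub_le hb hL hx⟩
  · nlinarith [millsRatio_le_three hx]
  · rw [abs_mul, abs_of_nonneg hx]
    nlinarith [mul_millsRatio_le_one hx]

theorem gaussTail_bounds (hb : ∀ y, |h y| ≤ b) (hL : LipschitzWith 1 h)
    (h0 : ∫ y, h y * gaussWeight y = 0) (x : ℝ) :
    |gaussTail h x| ≤ 3 * b ∧ |x * gaussTail h x| ≤ b ∧
      |(1 + x ^ 2) * gaussTail h x - x * h x| ≤ 3 * b + 1 := by
  obtain hx | hx := le_total 0 x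
  · exact gaussTail_bounds_of_nonneg hb hL hx
  · have reflected := gaussTail_neg (integrable_mul_gaussWeight_of_abs_le hL.continuous hb) h0 (-x)
    have hL' : LipschitzWith 1 fun y => h (-y) := by
      simpa using! hL.comp LipschitzWith.id.neg
    have bounds := gaussTail_bounds_of_nonneg (fun y => hb (-y)) hL' (neg_nonneg.2 hx)
    rw [neg_neg] at reflected
    rw [eq_comm, neg_eq_iff_eq_neg] at reflected
    rw [reflected, neg_neg, neg_sq, abs_neg, neg_mul_neg, mul_neg, neg_mul, ← neg_sub', abs_neg]
      at bounds
    exact bounds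

end Bounds

theorem lipschitzWith_of_hasDerivAt_of_abs_le {f f' : ℝ → ℝ} {K : ℝ≥0}
    (hf : ∀ x, HasDerivAt f (f' x) x) (hK : ∀ x, |f' x| ≤ K) : LipschitzWith K f :=
  lipschitzWith_of_nnnorm_deriv_le (fun x => (hf x).differentiableAt) fun x => by
    rw [(hf x).deriv]
    exact hK x

theorem abs_sub_sub_mul_le_of_lipschitzWith {f f' : ℝ → ℝ} {K : ℝ≥0}
    (hf : ∀ x, HasDerivAt f (f' x) x) (hK : LipschitzWith K f') (x y : ℝ) :
    |f x - f y - f' y * (x - y)| ≤ K * (x - y) ^ 2 := by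
  have deriv (z : ℝ) : HasDerivAt (fun z => f z - f' y * z) (f' z - f' y) z := by
    simpa using (hf z).fun_sub ((hasDerivAt_id z).const_mul (f' y))
  have bound (z : ℝ) (hz : z ∈ Set.uIcc y x) : ‖f' z - f' y‖ ≤ K * |x - y| := by
    refine (hK.norm_sub_le z y).trans ?_
    gcongr
    exact Set.abs_sub_left_of_mem_uIcc hz
  have := Convex.norm_image_sub_le_of_norm_hasDerivWithin_le
    (fun z _ => (deriv z).hasDerivWithinAt) bound (convex_uIcc y x) Set.left_mem_uIcc
    Set.right_mem_uIcc
  rw [Real.norm_eq_abs, Real.norm_eq_abs, mul_assoc, ← sq, sq_abs] at this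
  convert this using 2
  ring

theorem exists_stein_solution {s : ℝ → ℝ} (hs : ∀ x, |s x| ≤ 1) (hL : LipschitzWith 1 s) :
    ∃ f f' : ℝ → ℝ, (∀ x, HasDerivAt f (f' x) x) ∧
      (∀ x, f' x = x * f x + (s x - ∫ y, s y ∂gaussianReal 0 1)) ∧
      (∀ x, |f x| ≤ 8) ∧ (∀ x, |f' x| ≤ 8) ∧ LipschitzWith 8 f' := by
  set a := ∫ y, s y ∂gaussianReal 0 1 with ha
  let h x := s x - a
  have ha1 : |a| ≤ 1 := by
    simpa using norm_integral_le_of_norm_le_const (μ := gaussianReal 0 1) (f := s) (ae_of_all _ hs)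
  have hb (x : ℝ) : |h x| ≤ 2 := (abs_sub _ _).trans (by linarith [hs x])
  have hLh : LipschitzWith 1 h := by simpa using hL.sub (LipschitzWith.const a)
  have centred : ∫ y, h y * gaussWeight y = 0 := by
    have mean := integral_gaussianReal_eq_integral_mul_gaussWeight h
    have hsi : Integrable s (gaussianReal 0 1) :=
      .of_bound hL.continuous.aestronglyMeasurable 1 (ae_of_all _ hs)
    rw [integral_sub hsi (integrable_const a), ← ha, integral_const, probReal_univ, one_smul,
      sub_self, eq_comm] at mean
    exact (mul_eq_zero.1 mean).resolve_left (by positivity)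
  have bounds := gaussTail_bounds hb hLh centred
  have hi := integrable_mul_gaussWeight_of_abs_le hLh.continuous hb
  have deriv (x : ℝ) : HasDerivAt (fun x => -gaussTail h x) (x * -gaussTail h x + h x) x :=
    (hasDerivAt_gaussTail hLh.continuous hi x).fun_neg.congr_deriv (by ring)
  refine ⟨fun x => -gaussTail h x, fun x => x * -gaussTail h x + h x, deriv, fun x => rfl,
    fun x => ?_, fun x => ?_, ?_⟩
  · rw [abs_neg]
    linarith [(bounds x).1]
  · refine (abs_add_le _ _).trans ?_
    rw [mul_neg, abs_neg]
    linarith [(bounds x).2.1, hb x]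
  · have lipschitz : LipschitzWith 7 fun x => x * -gaussTail h x := by
      refine lipschitzWith_of_hasDerivAt_of_abs_le
        (fun x => ((hasDerivAt_id x).mul (deriv x))) fun x => ?_
      have := (bounds x).2.2
      rw [← abs_neg] at this
      refine le_trans (le_of_eq ?_) (this.trans ?_)
      · congr 1
        simp only [id]
        ring
      · norm_num
    exact (lipschitz.add hLh).weaken (by norm_num)

end SteinEquation

section GaussianProduct

theorem integrable_pow_gaussianReal (p : ℕ) :
    Integrable (fun x : ℝ => x ^ p) (gaussianReal 0 1) := by
  refine (IsGaussian.memLp_id (gaussianReal 0 1) p (by simp)).integrable_norm_pow'.mono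
    (by fun_prop) (ae_of_all _ fun x => ?_)
  simp

theorem integral_sq_gaussianReal : ∫ x, x ^ 2 ∂gaussianReal 0 1 = 1 := by
  have h := variance_fun_id_gaussianReal (μ := 0) (v := 1)
  rw [variance_eq_integral (by fun_prop)] at h
  simpa using h

/-- The fourth moment of the standard Gaussian distribution; only its finiteness matters here. -/
def gaussFourthMoment : ℝ := ∫ x, x ^ 4 ∂gaussianReal 0 1

theorem gaussFourthMoment_nonneg : 0 ≤ gaussFourthMoment := integral_nonneg fun x => by positivity

variable {κ : Type*} [Fintype κ]

theorem integrable_eval_pow (k : κ) (p : ℕ) :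
    Integrable (fun x : κ → ℝ => x k ^ p) (stdGaussianPi κ) :=
  integrable_comp_eval (integrable_pow_gaussianReal p)

theorem integral_eval_sq (k : κ) : ∫ x, x k ^ 2 ∂stdGaussianPi κ = 1 :=
  (integral_comp_eval (μ := fun _ : κ => gaussianReal 0 1) (f := fun t => t ^ 2)
    (by fun_prop)).trans integral_sq_gaussianReal

theorem integral_eval_pow_four (k : κ) : ∫ x, x k ^ 4 ∂stdGaussianPi κ = gaussFourthMoment :=
  integral_comp_eval (μ := fun _ : κ => gaussianReal 0 1) (f := fun t => t ^ 4) (by fun_prop)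

theorem integrable_eval_pow_mul (k : κ) (p : ℕ) {g : (κ → ℝ) → ℝ} (hg : Continuous g) {C : ℝ}
    (hC : ∀ x, |g x| ≤ C) : Integrable (fun x => x k ^ p * g x) (stdGaussianPi κ) :=
  (integrable_eval_pow k p).mul_bdd hg.aestronglyMeasurable (ae_of_all _ hC)

variable [DecidableEq κ]

theorem indepFun_eval_update (k : κ) :
    IndepFun (fun x : κ → ℝ => x k) (fun x => Function.update x k 0) (stdGaussianPi κ) := by
  have indep : iIndepFun (fun (l : κ) (x : κ → ℝ) => x l) (stdGaussianPi κ) :=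
    iIndepFun_pi (X := fun _ (x : ℝ) => x) fun _ => aemeasurable_id
  let extend (a : ↥(Finset.univ.erase k) → ℝ) (l : κ) : ℝ :=
    if hl : l ∈ Finset.univ.erase k then a ⟨l, hl⟩ else 0
  have measurable_extend : Measurable extend := measurable_pi_lambda _ fun l => by
    by_cases hl : l ∈ Finset.univ.erase k
    · simpa only [extend, hl, dite_true] using measurable_pi_apply _
    · simpa only [extend, hl, dite_false] using measurable_const
  convert! (indep.indepFun_finset {k} (Finset.univ.erase k) (by simp)
    fun l => measurable_pi_apply l).comp
      (measurable_pi_apply ⟨k, Finset.mem_singleton_self k⟩) measurable_extend using 1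
  funext x l
  obtain rfl | hl := eq_or_ne l k
  · simp [extend]
  · simp [extend, hl]

theorem integral_eval_mul_update (k : κ) {φ : ℝ → ℝ} (hφ : Measurable φ) {g : (κ → ℝ) → ℝ}
    (hg : Measurable g) :
    ∫ x, φ (x k) * g (Function.update x k 0) ∂stdGaussianPi κ =
      (∫ t, φ t ∂gaussianReal 0 1) * ∫ x, g (Function.update x k 0) ∂stdGaussianPi κ := by
  rw [← integral_comp_eval (μ := fun _ : κ => gaussianReal 0 1) (i := k)
    hφ.aestronglyMeasurable]
  exact ((indepFun_eval_update k).comp hφ hg).integral_fun_mul_eq_mul_integral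
    (hφ.comp (measurable_pi_apply k)).aestronglyMeasurable
    (hg.comp (by fun_prop)).aestronglyMeasurable

theorem integral_eval_mul_update_add_eq_zero (k : κ) {g h : (κ → ℝ) → ℝ} (hg : Continuous g)
    (hh : Continuous h) {C : ℝ} (hgC : ∀ x, |g x| ≤ C) (hhC : ∀ x, |h x| ≤ C) (c : ℝ) :
    Integrable (fun x => x k * g (Function.update x k 0) +
        c * ((x k ^ 2 - 1) * h (Function.update x k 0))) (stdGaussianPi κ) ∧
      ∫ x, (x k * g (Function.update x k 0) +
        c * ((x k ^ 2 - 1) * h (Function.update x k 0))) ∂stdGaussianPi κ = 0 := by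
  have hu : Continuous fun x : κ → ℝ => Function.update x k 0 := by fun_prop
  have int_g : Integrable (fun x => x k * g (Function.update x k 0)) (stdGaussianPi κ) := by
    simpa using integrable_eval_pow_mul k 1 (hg.comp hu) fun x => hgC _
  have int_h : Integrable (fun x => c * ((x k ^ 2 - 1) * h (Function.update x k 0)))
      (stdGaussianPi κ) := by
    refine Integrable.const_mul ?_ c
    simpa [sub_mul] using! (integrable_eval_pow_mul k 2 (hh.comp hu) fun x => hhC _).sub
      (integrable_eval_pow_mul k 0 (hh.comp hu) fun x => hhC _)
  refine ⟨int_g.fun_add int_h, ?_⟩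
  rw [integral_add int_g int_h, integral_eval_mul_update k (φ := fun t => t) measurable_id
    hg.measurable, integral_const_mul, integral_eval_mul_update k (φ := fun t => t ^ 2 - 1)
    (by fun_prop) hh.measurable, integral_sub (integrable_pow_gaussianReal 2)
    (integrable_const _), integral_sq_gaussianReal, integral_id_gaussianReal]
  simp

theorem abs_integral_eval_mul_sub_integral_le (k : κ) {g h E : (κ → ℝ) → ℝ} (hg : Continuous g)
    (hh : Continuous h) {C : ℝ} (hgC : ∀ x, |g x| ≤ C) (hhC : ∀ x, |h x| ≤ C) (c : ℝ)
    (hE : Integrable E (stdGaussianPi κ))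
    (hle : ∀ x, |x k * g x - c * h x - (x k * g (Function.update x k 0) +
      c * ((x k ^ 2 - 1) * h (Function.update x k 0)))| ≤ E x) :
    |∫ x, x k * g x ∂stdGaussianPi κ - c * ∫ x, h x ∂stdGaussianPi κ| ≤
      ∫ x, E x ∂stdGaussianPi κ := by
  have int_g : Integrable (fun x => x k * g x) (stdGaussianPi κ) := by
    simpa using integrable_eval_pow_mul k 1 hg hgC
  have int_h : Integrable (fun x => c * h x) (stdGaussianPi κ) :=
    (Integrable.of_bound hh.aestronglyMeasurable C (ae_of_all _ hhC)).const_mul c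
  have int_sub : Integrable (fun x => x k * g x - c * h x) (stdGaussianPi κ) := int_g.sub int_h
  obtain ⟨int_update, integral_update⟩ :=
    integral_eval_mul_update_add_eq_zero k hg hh hgC hhC c
  rw [← integral_const_mul, ← integral_sub int_g int_h,
    ← sub_zero (∫ x, (x k * g x - c * h x) ∂stdGaussianPi κ), ← integral_update,
    ← integral_sub int_sub int_update]
  exact abs_integral_le_integral_abs.trans
    (integral_mono_of_nonneg (ae_of_all _ fun x => abs_nonneg _) hE (ae_of_all _ hle))

end GaussianProduct

section FunctionalCalculus

variable {ι : Type*} [Fintype ι] [DecidableEq ι]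

theorem continuous_cfc_of_lipschitzWith {α : Type*} [TopologicalSpace α] {A : α → Matrix ι ι ℂ}
    (hc : Continuous A) (hA : ∀ x, (A x).IsHermitian) {f : ℝ → ℝ} {K : ℝ≥0}
    (hf : LipschitzWith K f) : Continuous fun x => cfc f (A x) := by
  refine continuous_pi fun i => continuous_pi fun j => continuous_iff_continuousAt.2 fun x₀ => ?_
  rw [ContinuousAt, tendsto_iff_norm_sub_tendsto_zero]
  have h : Tendsto (fun x => √(Fintype.card ι * (K ^ 2 * hsNormSq (A x - A x₀)))) (𝓝 x₀)
      (𝓝 0) := by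
    have := continuous_hsNormSq.comp (hc.sub (continuous_const (y := A x₀)))
    have : Continuous fun x => √(Fintype.card ι * (K ^ 2 * hsNormSq (A x - A x₀))) := by
      fun_prop
    simpa [hsNormSq] using this.tendsto x₀
  refine squeeze_zero (fun x => norm_nonneg _) (fun x => Real.le_sqrt_of_sq_le ?_) h
  refine (norm_entry_sq_le_hsNormSq (cfc f (A x) - cfc f (A x₀)) i j).trans ?_
  gcongr
  exact hsNormSq_cfc_sub_cfc_le (hA x) (hA x₀) hf

theorem ntr_mul_cfc {A : Matrix ι ι ℂ} (hA : A.IsHermitian) (f : ℝ → ℝ) :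
    ntr (A * cfc f A) = ntr (cfc (fun t => t * f t) A) := by
  rw [cfc_mul (fun t => t) f A (continuousOn_real_spectrum _ _) (continuousOn_real_spectrum _ _),
    cfc_id' ℝ A hA.isSelfAdjoint]

variable [Nonempty ι] {A : Matrix ι ι ℂ} {f : ℝ → ℝ} {C : ℝ}

theorem abs_ntr_cfc_le (hA : A.IsHermitian) (hC : ∀ x, |f x| ≤ C) : |ntr (cfc f A)| ≤ C := by
  have := isProbabilityMeasure_spectralMeasure hA
  rw [← integral_spectralMeasure hA]
  simpa using norm_integral_le_of_norm_le_const (μ := spectralMeasure hA) (f := f) (ae_of_all _ hC)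

theorem hsNormSq_cfc_le (hA : A.IsHermitian) (hC : ∀ x, |f x| ≤ C) :
    hsNormSq (cfc f A) ≤ C ^ 2 := by
  rw [← doubleCfc_left hA hA, hsNormSq_doubleCfc, ← one_mul (C ^ 2), ← sum_overlap hA hA,
    Finset.sum_mul]
  refine Finset.sum_le_sum fun p _ => mul_le_mul_of_nonneg_left ?_ (overlap_nonneg hA hA p)
  exact sq_le_sq.2 ((hC _).trans (le_abs_self C))

end FunctionalCalculus

section Bias

variable {κ ι : Type*} [Fintype κ] [Fintype ι] {D : ℕ} {b : κ → Matrix ι ι ℂ}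

/-- The polynomial of the coefficients that controls the error made when the coefficient `k` is
set to `0` in a local spin family with parameter `D`. -/
def leaveOneOutError (D : ℕ) (b : κ → Matrix ι ι ℂ) (k : κ) (x : κ → ℝ) : ℝ :=
  1 + 2 * x k ^ 2 + 4 * D * ∑ l ∈ noncommuting b k, (x k ^ 4 + x l ^ 4) + 2 * x k ^ 4

/-- The constant in the bound for the bias of the linear statistics of a local spin family with
parameter `D`. -/
def biasConst (D : ℕ) : ℝ := 4 * (3 + (8 * D ^ 2 + 2) * gaussFourthMoment)

theorem biasConst_nonneg (D : ℕ) : 0 ≤ biasConst D := by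
  have := gaussFourthMoment_nonneg
  unfold biasConst
  positivity

theorem integrable_leaveOneOutError (D : ℕ) (b : κ → Matrix ι ι ℂ) (k : κ) :
    Integrable (leaveOneOutError D b k) (stdGaussianPi κ) := by
  have h2 := integrable_eval_pow k 2
  have h4 (l : κ) := integrable_eval_pow l 4
  exact (((integrable_const _).add (h2.const_mul _)).add (Integrable.const_mul
    (integrable_finsetSum _ fun l _ => (h4 k).add (h4 l)) _)).add ((h4 k).const_mul _)

theorem ntr_spinSum_mul (b : κ → Matrix ι ι ℂ) (x : κ → ℝ) (M : Matrix ι ι ℂ) :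
    ntr (spinSum b x * M) = (√(Fintype.card κ))⁻¹ * ∑ k, x k * ntr (b k * M) := by
  simp only [spinSum_apply, smul_mul_assoc, Finset.sum_mul, map_smul, map_sum, smul_eq_mul]

variable [DecidableEq ι]

namespace IsLocalSpinFamily

theorem integral_leaveOneOutError_le (hb : IsLocalSpinFamily D b) (k : κ) :
    ∫ x, leaveOneOutError D b k x ∂stdGaussianPi κ ≤ 3 + (8 * D ^ 2 + 2) * gaussFourthMoment := by
  have h2 := integrable_eval_pow k 2
  have h4 (l : κ) := integrable_eval_pow l 4
  have : Integrable (fun x => ∑ l ∈ noncommuting b k, (x k ^ 4 + x l ^ 4))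
      (stdGaussianPi κ) := integrable_finsetSum _ fun l _ => (h4 k).add (h4 l)
  have integral_sum : ∫ x, ∑ l ∈ noncommuting b k, (x k ^ 4 + x l ^ 4) ∂stdGaussianPi κ =
      (noncommuting b k).card * (2 * gaussFourthMoment) := by
    rw [integral_finsetSum _ fun l _ => (h4 k).fun_add (h4 l)]
    simp_rw [integral_add (h4 k) (h4 _), integral_eval_pow_four]
    rw [Finset.sum_const, nsmul_eq_mul, two_mul]
  have integral_eq : ∫ x, leaveOneOutError D b k x ∂stdGaussianPi κ =
      1 + 2 * 1 + 4 * D * ((noncommuting b k).card * (2 * gaussFourthMoment)) +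
        2 * gaussFourthMoment := by
    simp only [leaveOneOutError]
    rw [integral_add, integral_add, integral_add, integral_const_mul, integral_const_mul,
      integral_const_mul, integral_sum, integral_eval_sq, integral_eval_pow_four]
    · simp
    all_goals fun_prop
  rw [integral_eq]
  have hcard : ((noncommuting b k).card : ℝ) ≤ D := mod_cast hb.card_noncommuting_le k
  have hm := gaussFourthMoment_nonneg
  calc 1 + 2 * 1 + 4 * D * ((noncommuting b k).card * (2 * gaussFourthMoment)) +
        2 * gaussFourthMoment
      ≤ 1 + 2 * 1 + 4 * D * (D * (2 * gaussFourthMoment)) + 2 * gaussFourthMoment := by gcongr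
    _ = 3 + (8 * D ^ 2 + 2) * gaussFourthMoment := by ring

theorem continuous_cfc_spinSum (hb : IsLocalSpinFamily D b) {f : ℝ → ℝ} {K : ℝ≥0}
    (hf : LipschitzWith K f) : Continuous fun x => cfc f (spinSum b x) :=
  continuous_cfc_of_lipschitzWith (continuous_spinSum b) hb.isHermitian_spinSum hf

variable [Nonempty ι] {f f' : ℝ → ℝ} {K : ℝ≥0}

theorem abs_ntr_apply_mul_cfc_le (hb : IsLocalSpinFamily D b) (hf : ∀ t, |f t| ≤ K) (k : κ)
    {A : Matrix ι ι ℂ} (hA : A.IsHermitian) : |ntr (b k * cfc f A)| ≤ (1 + K ^ 2) / 2 := by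
  refine (abs_ntr_mul_le _ _).trans ?_
  rw [hb.hsNormSq_apply]
  gcongr
  exact hsNormSq_cfc_le hA hf

theorem sqrt_hsNormSq_spinSum_sub (hb : IsLocalSpinFamily D b) (x y : EuclideanSpace ℝ κ) :
    √(hsNormSq (spinSum b x.ofLp - spinSum b y.ofLp)) =
      ((NNReal.sqrt (Fintype.card κ))⁻¹ : ℝ≥0) * dist x y := by
  rw [← map_sub, hb.hsNormSq_spinSum, Real.sqrt_mul (by positivity), Real.sqrt_inv,
    EuclideanSpace.dist_eq]
  simp [Real.dist_eq, Real.coe_sqrt]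

theorem lipschitzWith_ntr_cfc_spinSum (hb : IsLocalSpinFamily D b) (hf : LipschitzWith K f) :
    LipschitzWith (K * (NNReal.sqrt (Fintype.card κ))⁻¹)
      fun x : EuclideanSpace ℝ κ => ntr (cfc f (spinSum b x.ofLp)) := by
  refine LipschitzWith.of_dist_le_mul fun x y => ?_
  rw [Real.dist_eq, NNReal.coe_mul, mul_assoc, ← hb.sqrt_hsNormSq_spinSum_sub]
  exact abs_ntr_cfc_sub_ntr_cfc_le (hb.isHermitian_spinSum _) (hb.isHermitian_spinSum _) hf

theorem abs_expansion_ntr_apply_mul_cfc_le [DecidableEq κ] (hb : IsLocalSpinFamily D b)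
    (x : κ → ℝ) (k : κ) {A B : Matrix ι ι ℂ} (hA : A = spinSum b x)
    (hB : B = spinSum b (Function.update x k 0))
    (hf : ∀ s t, |f s - f t - f' t * (s - t)| ≤ K * (s - t) ^ 2) :
    |x k * ntr (b k * cfc f A) - x k * ntr (b k * cfc f B) -
        (√(Fintype.card κ))⁻¹ * (x k ^ 2 * ntr (cfc f' B))| ≤
      K / 2 * ((Fintype.card κ : ℝ)⁻¹ * (x k ^ 2 +
        (4 * D * ∑ l ∈ noncommuting b k, (x k ^ 4 + x l ^ 4) + 2 * x k ^ 4))) := by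
  have hc : 0 < (√(Fintype.card κ))⁻¹ :=
    inv_pos.2 (Real.sqrt_pos.2 (Nat.cast_pos.2 (Fintype.card_pos_iff.2 ⟨k⟩)))
  have taylor := abs_ntr_sub_mul_cfc_sub_cfc_sub_le (hA ▸ hb.isHermitian_spinSum x)
    (hB ▸ hb.isHermitian_spinSum _) hc hf
  have commutator := hb.hsNormSq_second_difference_le x k hA hB
  have hAB : A - B = ((√(Fintype.card κ))⁻¹ * x k) • b k := by
    rw [hA, hB, spinSum_sub_spinSum_update]
  rw [← sq_inv_sqrt_card] at commutator ⊢
  set c := (√(Fintype.card κ))⁻¹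
  set P := 4 * D * ∑ l ∈ noncommuting b k, (x k ^ 4 + x l ^ 4) + 2 * x k ^ 4
  have first : ntr ((A - B) * (cfc f A - cfc f B)) =
      c * (x k * ntr (b k * cfc f A) - x k * ntr (b k * cfc f B)) := by
    rw [hAB, smul_mul_assoc, Matrix.mul_sub, map_smul, map_sub, smul_eq_mul]
    ring
  have second : ntr ((A - B) * ((A - B) * cfc f' B)) = c * (c * (x k ^ 2 * ntr (cfc f' B))) := by
    rw [hAB, ← mul_assoc, smul_mul_smul_comm, hb.mul_self, smul_mul_assoc, one_mul, map_smul,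
      smul_eq_mul]
    ring
  have norm_sub : hsNormSq (A - B) = c ^ 2 * x k ^ 2 := by
    rw [hAB, hsNormSq_smul, hb.hsNormSq_apply, mul_one, mul_pow]
  rw [first, second, norm_sub, ← mul_sub, abs_mul, abs_of_pos hc] at taylor
  refine le_of_mul_le_mul_left (taylor.trans ?_) hc
  calc K / 2 * (c * (c ^ 2 * x k ^ 2) + c⁻¹ * hsNormSq (A * (A - B) - (A - B) * B))
      ≤ K / 2 * (c * (c ^ 2 * x k ^ 2) + c⁻¹ * ((c ^ 2) ^ 2 * P)) := by gcongr
    _ = c * (K / 2 * (c ^ 2 * (x k ^ 2 + P))) := by field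

theorem abs_leave_one_out_expansion_le [DecidableEq κ] (hb : IsLocalSpinFamily D b)
    (x : κ → ℝ) (k : κ) (hf : ∀ s t, |f s - f t - f' t * (s - t)| ≤ K * (s - t) ^ 2)
    (hf' : LipschitzWith K f') :
    |x k * ntr (b k * cfc f (spinSum b x)) -
        (√(Fintype.card κ))⁻¹ * ntr (cfc f' (spinSum b x)) -
        (x k * ntr (b k * cfc f (spinSum b (Function.update x k 0))) + (√(Fintype.card κ))⁻¹ *
          ((x k ^ 2 - 1) * ntr (cfc f' (spinSum b (Function.update x k 0)))))| ≤
      K / 2 * ((Fintype.card κ : ℝ)⁻¹ * leaveOneOutError D b k x) := by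
  have second_order := hb.abs_expansion_ntr_apply_mul_cfc_le x k rfl rfl hf
  have first_order := abs_ntr_cfc_sub_ntr_cfc_le (hb.isHermitian_spinSum x)
    (hb.isHermitian_spinSum (Function.update x k 0)) hf'
  have hc : 0 ≤ (√(Fintype.card κ))⁻¹ := by positivity
  rw [spinSum_sub_spinSum_update, hsNormSq_smul, hb.hsNormSq_apply, mul_one,
    Real.sqrt_sq_eq_abs, abs_mul, abs_of_nonneg hc] at first_order
  rw [← sq_inv_sqrt_card] at second_order ⊢
  set c := (√(Fintype.card κ))⁻¹
  set A := spinSum b x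
  set B := spinSum b (Function.update x k 0)
  have am_gm : |x k| ≤ (1 + x k ^ 2) / 2 := by
    linarith [two_mul_le_add_sq 1 |x k|, sq_abs (x k)]
  have diagonal : |c * (ntr (cfc f' A) - ntr (cfc f' B))| ≤
      K / 2 * (c ^ 2 * (1 + x k ^ 2)) := by
    rw [abs_mul, abs_of_nonneg hc]
    calc c * |ntr (cfc f' A) - ntr (cfc f' B)| ≤ c * (K * (c * ((1 + x k ^ 2) / 2))) := by
          refine mul_le_mul_of_nonneg_left (first_order.trans ?_) hc
          gcongr
      _ = K / 2 * (c ^ 2 * (1 + x k ^ 2)) := by ring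
  calc _ = |(x k * ntr (b k * cfc f A) - x k * ntr (b k * cfc f B) -
        c * (x k ^ 2 * ntr (cfc f' B))) - c * (ntr (cfc f' A) - ntr (cfc f' B))| := by ring_nf
    _ ≤ _ := (abs_sub _ _).trans (add_le_add second_order diagonal)
    _ = K / 2 * (c ^ 2 * leaveOneOutError D b k x) := by rw [leaveOneOutError]; ring

theorem abs_integral_eval_mul_ntr_sub_le (hb : IsLocalSpinFamily D b) (k : κ)
    (hfL : LipschitzWith K f) (hfK : ∀ t, |f t| ≤ K) (hf'K : ∀ t, |f' t| ≤ K)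
    (hf : ∀ s t, |f s - f t - f' t * (s - t)| ≤ K * (s - t) ^ 2) (hf' : LipschitzWith K f') :
    |∫ x, x k * ntr (b k * cfc f (spinSum b x)) ∂stdGaussianPi κ -
        (√(Fintype.card κ))⁻¹ * ∫ x, ntr (cfc f' (spinSum b x)) ∂stdGaussianPi κ| ≤
      K / 2 * ((Fintype.card κ : ℝ)⁻¹ * (3 + (8 * D ^ 2 + 2) * gaussFourthMoment)) := by
  classical
  refine (abs_integral_eval_mul_sub_integral_le k
    (continuous_ntr.comp (continuous_const.mul (hb.continuous_cfc_spinSum hfL)))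
    (continuous_ntr.comp (hb.continuous_cfc_spinSum hf'))
    (fun x => (hb.abs_ntr_apply_mul_cfc_le hfK k (hb.isHermitian_spinSum x)).trans
      (le_max_left _ (K : ℝ)))
    (fun x => (abs_ntr_cfc_le (hb.isHermitian_spinSum x) hf'K).trans (le_max_right _ _)) _
    (((integrable_leaveOneOutError D b k).const_mul _).const_mul _)
    fun x => hb.abs_leave_one_out_expansion_le x k hf hf').trans ?_
  rw [integral_const_mul, integral_const_mul]
  gcongr
  exact hb.integral_leaveOneOutError_le k

theorem ntr_cfc_stein_solution (hb : IsLocalSpinFamily D b) {s : ℝ → ℝ} {a : ℝ}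
    (hs : ∀ t, f' t = t * f t + (s t - a)) (x : κ → ℝ) :
    ntr (cfc s (spinSum b x)) - a = ntr (cfc f' (spinSum b x)) -
      (√(Fintype.card κ))⁻¹ * ∑ k, x k * ntr (b k * cfc f (spinSum b x)) := by
  have hA := hb.isHermitian_spinSum x
  rw [← ntr_spinSum_mul, ntr_mul_cfc hA]
  simp only [ntr_cfc_eq_sum hA, hs, Finset.sum_add_distrib, Finset.sum_sub_distrib, mul_add,
    mul_sub, Finset.sum_const, Finset.card_univ, nsmul_eq_mul]
  rw [inv_mul_cancel_left₀ (by simp)]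
  ring

theorem integral_ntr_cfc_sub_eq_sum [Nonempty κ] (hb : IsLocalSpinFamily D b) {s : ℝ → ℝ} {a : ℝ}
    (hs : ∀ t, f' t = t * f t + (s t - a)) (hsL : LipschitzWith 1 s) (hs1 : ∀ t, |s t| ≤ 1)
    (hfL : LipschitzWith K f) (hfK : ∀ t, |f t| ≤ K) (hf'K : ∀ t, |f' t| ≤ K)
    (hf' : LipschitzWith K f') :
    ∫ x, ntr (cfc s (spinSum b x)) ∂stdGaussianPi κ - a = -((√(Fintype.card κ))⁻¹ *
      ∑ k, (∫ x, x k * ntr (b k * cfc f (spinSum b x)) ∂stdGaussianPi κ -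
        (√(Fintype.card κ))⁻¹ * ∫ x, ntr (cfc f' (spinSum b x)) ∂stdGaussianPi κ)) := by
  have card_pos : (0 : ℝ) < Fintype.card κ := Nat.cast_pos.2 Fintype.card_pos
  have int_apply (k : κ) : Integrable (fun x => x k * ntr (b k * cfc f (spinSum b x)))
      (stdGaussianPi κ) := by
    simpa using integrable_eval_pow_mul k 1
      (continuous_ntr.comp (continuous_const.mul (hb.continuous_cfc_spinSum hfL)))
      fun x => hb.abs_ntr_apply_mul_cfc_le hfK k (hb.isHermitian_spinSum x)
  have int_deriv : Integrable (fun x => ntr (cfc f' (spinSum b x))) (stdGaussianPi κ) :=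
    .of_bound (continuous_ntr.comp (hb.continuous_cfc_spinSum hf')).aestronglyMeasurable K
      (ae_of_all _ fun x => abs_ntr_cfc_le (hb.isHermitian_spinSum x) hf'K)
  have int_s : Integrable (fun x => ntr (cfc s (spinSum b x))) (stdGaussianPi κ) :=
    .of_bound (continuous_ntr.comp (hb.continuous_cfc_spinSum hsL)).aestronglyMeasurable 1
      (ae_of_all _ fun x => abs_ntr_cfc_le (hb.isHermitian_spinSum x) hs1)
  have stein : ∫ x, (ntr (cfc s (spinSum b x)) - a) ∂stdGaussianPi κ =
      ∫ x, ntr (cfc f' (spinSum b x)) ∂stdGaussianPi κ - (√(Fintype.card κ))⁻¹ *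
        ∑ k, ∫ x, x k * ntr (b k * cfc f (spinSum b x)) ∂stdGaussianPi κ := by
    simp_rw [hb.ntr_cfc_stein_solution hs]
    rw [integral_sub int_deriv ((integrable_finsetSum _ fun k _ => int_apply k).const_mul _),
      integral_const_mul, integral_finsetSum _ fun k _ => int_apply k]
  rw [integral_sub int_s (integrable_const _), integral_const, probReal_univ, one_smul] at stein
  rw [stein, Finset.sum_sub_distrib, Finset.sum_const, Finset.card_univ, nsmul_eq_mul, mul_sub,
    mul_left_comm, ← mul_assoc _ _ (integral _ _), ← sq, sq_inv_sqrt_card,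
    mul_inv_cancel_left₀ card_pos.ne']
  ring

theorem abs_integral_ntr_cfc_sub_integral_gaussianReal_le [Nonempty κ]
    (hb : IsLocalSpinFamily D b) {s : ℝ → ℝ} (hs : ∀ t, |s t| ≤ 1) (hsL : LipschitzWith 1 s) :
    |∫ x, ntr (cfc s (spinSum b x)) ∂stdGaussianPi κ - ∫ t, s t ∂gaussianReal 0 1| ≤
      biasConst D * (√(Fintype.card κ))⁻¹ := by
  obtain ⟨f, f', hf, stein, hf8, hf'8, hf'L⟩ := exists_stein_solution hs hsL
  have hfL : LipschitzWith 8 f := lipschitzWith_of_hasDerivAt_of_abs_le hf hf'8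
  have card_pos : (0 : ℝ) < Fintype.card κ := Nat.cast_pos.2 Fintype.card_pos
  rw [hb.integral_ntr_cfc_sub_eq_sum stein hsL hs hfL hf8 hf'8 hf'L, abs_neg, abs_mul,
    abs_of_nonneg (by positivity), mul_comm]
  gcongr
  refine (Finset.abs_sum_le_sum_abs _ _).trans ((Finset.sum_le_sum fun k _ =>
    hb.abs_integral_eval_mul_ntr_sub_le k hfL hf8 hf'8
      (abs_sub_sub_mul_le_of_lipschitzWith hf hf'L) hf'L).trans_eq ?_)
  rw [Finset.sum_const, Finset.card_univ, nsmul_eq_mul, mul_left_comm,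
    mul_inv_cancel_left₀ card_pos.ne', biasConst]
  push_cast
  ring

end IsLocalSpinFamily

end Bias

section BoundedLipschitz

variable {f : ℝ → ℝ} {μ ν : Measure ℝ}

theorem abs_le_one_of_blNorm_le_one (hf : blNorm f ≤ 1) (x : ℝ) : |f x| ≤ 1 := by
  have : ‖f x‖ₑ ≤ 1 := (le_iSup (fun x => ‖f x‖ₑ) x).trans (le_self_add.trans hf)
  rwa [Real.enorm_eq_ofReal_abs, ENNReal.ofReal_le_one] at this

theorem lipschitzWith_one_of_blNorm_le_one (hf : blNorm f ≤ 1) : LipschitzWith 1 f := by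
  intro x y
  obtain rfl | hxy := eq_or_ne x y
  · simp
  refine (ENNReal.div_le_iff (edist_pos.2 hxy).ne' (edist_ne_top x y)).1 ?_
  exact (le_iSup₂ (f := fun x y => edist (f x) (f y) / edist x y) x y).trans (le_add_self.trans hf)

theorem blNorm_zero : blNorm (fun _ => 0) = 0 := by simp [blNorm]

theorem dBL_le {r : ℝ} (h : ∀ f : ℝ → ℝ, blNorm f ≤ 1 → |∫ x, f x ∂μ - ∫ x, f x ∂ν| ≤ r) :
    dBL μ ν ≤ r := by
  refine csSup_le ⟨0, fun _ => 0, by simp [blNorm_zero], by simp⟩ ?_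
  rintro _ ⟨f, hf, rfl⟩
  exact h f hf

variable [IsProbabilityMeasure μ] [IsProbabilityMeasure ν]

theorem abs_integral_sub_integral_le_two (hf : ∀ x, |f x| ≤ 1) :
    |∫ x, f x ∂μ - ∫ x, f x ∂ν| ≤ 2 := by
  have abs_integral_le (ρ : Measure ℝ) [IsProbabilityMeasure ρ] : |∫ x, f x ∂ρ| ≤ 1 := by
    simpa using norm_integral_le_of_norm_le_const (μ := ρ) (f := f) (ae_of_all _ hf)
  refine (abs_sub _ _).trans ?_
  linarith [abs_integral_le μ, abs_integral_le ν]

theorem dBL_le_two : dBL μ ν ≤ 2 :=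
  dBL_le fun _ hf => abs_integral_sub_integral_le_two (abs_le_one_of_blNorm_le_one hf)

theorem le_dBL (hf : blNorm f ≤ 1) : |∫ x, f x ∂μ - ∫ x, f x ∂ν| ≤ dBL μ ν := by
  refine le_csSup ⟨2, ?_⟩ ⟨f, hf, rfl⟩
  rintro _ ⟨g, hg, rfl⟩
  exact abs_integral_sub_integral_le_two (abs_le_one_of_blNorm_le_one hg)

theorem dBL_nonneg : 0 ≤ dBL μ ν :=
  (abs_nonneg _).trans (le_dBL (f := fun _ => 0) (by simp [blNorm_zero]))

variable {ι : Type*} [Fintype ι] [DecidableEq ι] [Nonempty ι] {A B : Matrix ι ι ℂ}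

theorem dBL_spectralMeasure_le_add (hA : A.IsHermitian) (hB : B.IsHermitian) :
    dBL (spectralMeasure hA) ν ≤ dBL (spectralMeasure hB) ν + √(hsNormSq (A - B)) := by
  have := isProbabilityMeasure_spectralMeasure hB
  refine dBL_le fun f hf => ?_
  have spectral := abs_ntr_cfc_sub_ntr_cfc_le hA hB (lipschitzWith_one_of_blNorm_le_one hf)
  rw [NNReal.coe_one, one_mul, ← integral_spectralMeasure hA, ← integral_spectralMeasure hB]
    at spectral
  rw [add_comm]
  exact (abs_sub_le _ _ _).trans (add_le_add spectral (le_dBL hf))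

theorem abs_dBL_spectralMeasure_sub_le (hA : A.IsHermitian) (hB : B.IsHermitian) :
    |dBL (spectralMeasure hA) ν - dBL (spectralMeasure hB) ν| ≤ √(hsNormSq (A - B)) := by
  rw [abs_sub_le_iff, sub_le_iff_le_add', sub_le_iff_le_add']
  refine ⟨dBL_spectralMeasure_le_add hA hB, ?_⟩
  rw [← hsNormSq_neg, neg_sub]
  exact dBL_spectralMeasure_le_add hB hA

theorem continuous_dBL_spectralMeasure {X : Type*} [TopologicalSpace X] {A : X → Matrix ι ι ℂ}
    (hA : Continuous A) (hH : ∀ x, (A x).IsHermitian) :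
    Continuous fun x => dBL (spectralMeasure (hH x)) ν := by
  refine continuous_iff_continuousAt.2 fun y => tendsto_iff_norm_sub_tendsto_zero.2 ?_
  have bound : Continuous fun x => √(hsNormSq (A x - A y)) :=
    (continuous_hsNormSq.comp (hA.sub continuous_const)).sqrt
  refine squeeze_zero (fun _ => norm_nonneg _)
    (fun x => abs_dBL_spectralMeasure_sub_le (hH x) (hH y)) ?_
  simpa [hsNormSq_eq_ntr] using bound.tendsto y

end BoundedLipschitz

section Interpolation

/-- The function which increases with slope one from `0` to `ε` on `[c, c + ε]` and is constant
elsewhere. -/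
def ramp (c ε x : ℝ) : ℝ := max 0 (min (x - c) ε)

variable {c ε x : ℝ}

theorem ramp_of_le (h : x ≤ c) : ramp c ε x = 0 :=
  max_eq_left ((min_le_left _ _).trans (sub_nonpos.2 h))

theorem ramp_of_ge (hε : 0 ≤ ε) (h : c + ε ≤ x) : ramp c ε x = ε := by
  rw [ramp, min_eq_right (by linarith), max_eq_right hε]

theorem ramp_of_mem_Icc (h : x ∈ Set.Icc c (c + ε)) : ramp c ε x = x - c := by
  rw [ramp, min_eq_left (by linarith [h.2]), max_eq_right (sub_nonneg.2 h.1)]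

theorem abs_ramp_le (hε : 0 ≤ ε) : |ramp c ε x| ≤ ε := by
  rw [ramp, abs_of_nonneg (le_max_left _ _)]
  exact max_le hε (min_le_right _ _)

theorem lipschitzWith_ramp : LipschitzWith 1 (ramp c ε) :=
  ((IsometryEquiv.subRight c).isometry.lipschitz.min_const ε).const_max 0

/-- The slope of `f` over the cell `[a + k ε, a + (k + 1) ε]` of a grid. -/
def gridSlope (f : ℝ → ℝ) (a ε : ℝ) (k : ℕ) : ℝ := (f (a + (k + 1) * ε) - f (a + k * ε)) / ε

/-- The piecewise linear interpolation of `f` on the grid `a, a + ε, …, a + K ε`, constant outside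
`[a, a + K ε]`, as a combination of ramps. -/
def gridInterp (f : ℝ → ℝ) (a ε : ℝ) (K : ℕ) (x : ℝ) : ℝ :=
  f a + ∑ k ∈ Finset.range K, gridSlope f a ε k * ramp (a + k * ε) ε x

variable {f : ℝ → ℝ} {a : ℝ}

theorem abs_gridSlope_le (hε : 0 < ε) (hf : LipschitzWith 1 f) (k : ℕ) :
    |gridSlope f a ε k| ≤ 1 := by
  rw [gridSlope, abs_div, abs_of_pos hε, div_le_one hε]
  refine (hf.dist_le_mul _ _).trans_eq ?_
  rw [NNReal.coe_one, one_mul, Real.dist_eq, add_sub_add_left_eq_sub, ← sub_mul,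
    add_sub_cancel_left, one_mul, abs_of_pos hε]

theorem gridInterp_succ (f : ℝ → ℝ) (a ε : ℝ) (K : ℕ) (x : ℝ) :
    gridInterp f a ε (K + 1) x =
      gridInterp f a ε K x + gridSlope f a ε K * ramp (a + K * ε) ε x := by
  rw [gridInterp, Finset.sum_range_succ, ← add_assoc, gridInterp]

theorem gridInterp_of_le (hε : 0 ≤ ε) (K : ℕ) (hx : x ≤ a) : gridInterp f a ε K x = f a := by
  refine add_eq_left.2 (Finset.sum_eq_zero fun k _ => ?_)
  rw [ramp_of_le (hx.trans (le_add_of_nonneg_right (by positivity))), mul_zero]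

theorem gridInterp_of_ge (hε : 0 < ε) (K : ℕ) (hx : a + K * ε ≤ x) :
    gridInterp f a ε K x = f (a + K * ε) := by
  induction K with
  | zero => simp [gridInterp]
  | succ K ih =>
    push_cast at hx ⊢
    rw [gridInterp_succ, ih (by linarith), ramp_of_ge hε.le (by linarith), gridSlope,
      div_mul_cancel₀ _ hε.ne', add_sub_cancel]

theorem abs_sub_gridInterp_le (hε : 0 < ε) (hf : LipschitzWith 1 f) (K : ℕ)
    (hx : x ∈ Set.Icc a (a + K * ε)) : |f x - gridInterp f a ε K x| ≤ 2 * ε := by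
  induction K with
  | zero =>
    obtain rfl : x = a := by simpa using hx
    simpa [gridInterp] using hε.le
  | succ K ih =>
    have hxK : x ≤ a + K * ε + ε := by simpa [add_mul, add_assoc] using hx.2
    rw [gridInterp_succ]
    obtain h | h := le_total x (a + K * ε)
    · rw [ramp_of_le h, mul_zero, add_zero]
      exact ih ⟨hx.1, h⟩
    · rw [gridInterp_of_ge hε K h, ramp_of_mem_Icc ⟨h, hxK⟩, ← sub_sub]
      have cell : |x - (a + K * ε)| ≤ ε := by
        rw [abs_of_nonneg (sub_nonneg.2 h)]
        linarith
      have increment : |f x - f (a + K * ε)| ≤ ε := by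
        refine (hf.dist_le_mul x _).trans ?_
        rwa [NNReal.coe_one, one_mul]
      have slope : |gridSlope f a ε K * (x - (a + K * ε))| ≤ 1 * ε := by
        rw [abs_mul]
        gcongr
        exact abs_gridSlope_le hε hf K
      linarith [abs_sub (f x - f (a + K * ε)) (gridSlope f a ε K * (x - (a + K * ε)))]

theorem abs_sub_gridInterp_le_add_sq (hε : 0 < ε) (hf1 : ∀ x, |f x| ≤ 1) (hf : LipschitzWith 1 f)
    {K : ℕ} {R : ℝ} (hR : 0 < R) (hK : K * ε = 2 * R) (x : ℝ) :
    |f x - gridInterp f (-R) ε K x| ≤ 2 * ε + 2 / R ^ 2 * x ^ 2 := by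
  have outside (y : ℝ) (hx : R ≤ |x|) : |f x - f y| ≤ 2 * ε + 2 / R ^ 2 * x ^ 2 := by
    have : 1 ≤ x ^ 2 / R ^ 2 := by
      rw [one_le_div₀ (by positivity), ← sq_abs x]
      gcongr
    linarith [abs_sub (f x) (f y), hf1 x, hf1 y, div_mul_eq_mul_div 2 (R ^ 2) (x ^ 2),
      mul_div_assoc 2 (x ^ 2) (R ^ 2)]
  have right_end : -R + K * ε = R := by linarith
  obtain hl | hl := le_total x (-R)
  · rw [gridInterp_of_le hε.le K hl]
    exact outside _ (le_abs.2 (.inr (le_neg.2 hl)))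
  obtain hr | hr := le_total x R
  · refine (abs_sub_gridInterp_le hε hf K ⟨hl, hr.trans_eq right_end.symm⟩).trans ?_
    exact le_add_of_nonneg_right (by positivity)
  · rw [gridInterp_of_ge hε K (right_end.trans_le hr)]
    exact outside _ (le_abs.2 (.inl hr))

theorem integrable_ramp (μ : Measure ℝ) [IsFiniteMeasure μ] (hε : 0 ≤ ε) (c : ℝ) :
    Integrable (ramp c ε) μ :=
  .of_bound lipschitzWith_ramp.continuous.aestronglyMeasurable ε
    (ae_of_all _ fun _ => abs_ramp_le hε)

variable {μ ν : Measure ℝ} [IsProbabilityMeasure μ] [IsProbabilityMeasure ν]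

theorem integrable_gridInterp (hε : 0 ≤ ε) (f : ℝ → ℝ) (a : ℝ) (K : ℕ) :
    Integrable (gridInterp f a ε K) μ :=
  (integrable_const _).add (integrable_finsetSum _ fun _ _ => (integrable_ramp μ hε _).const_mul _)

theorem integral_gridInterp (hε : 0 ≤ ε) (f : ℝ → ℝ) (a : ℝ) (K : ℕ) :
    ∫ x, gridInterp f a ε K x ∂μ =
      f a + ∑ k ∈ Finset.range K, gridSlope f a ε k * ∫ x, ramp (a + k * ε) ε x ∂μ := by
  have hi (k : ℕ) : Integrable (fun x => gridSlope f a ε k * ramp (a + k * ε) ε x) μ :=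
    (integrable_ramp μ hε _).const_mul _
  simp only [gridInterp]
  rw [integral_add (integrable_const _) (integrable_finsetSum _ fun k _ => hi k),
    integral_finsetSum _ fun k _ => hi k]
  simp [integral_const_mul]

theorem abs_integral_sub_integral_gridInterp_le (hμ : Integrable (fun x => x ^ 2) μ) (hε : 0 < ε)
    (hf1 : ∀ x, |f x| ≤ 1) (hf : LipschitzWith 1 f) {K : ℕ} {R : ℝ} (hR : 0 < R)
    (hK : K * ε = 2 * R) :
    |∫ x, f x ∂μ - ∫ x, gridInterp f (-R) ε K x ∂μ| ≤ 2 * ε + 2 / R ^ 2 * ∫ x, x ^ 2 ∂μ := by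
  have int_f : Integrable f μ :=
    .of_bound hf.continuous.aestronglyMeasurable 1 (ae_of_all _ hf1)
  rw [← integral_sub int_f (integrable_gridInterp hε.le f _ K), ← Real.norm_eq_abs]
  calc ‖∫ x, (f x - gridInterp f (-R) ε K x) ∂μ‖
      ≤ ∫ x, (2 * ε + 2 / R ^ 2 * x ^ 2) ∂μ :=
        norm_integral_le_of_norm_le ((integrable_const _).fun_add (hμ.const_mul _))
          (ae_of_all _ (abs_sub_gridInterp_le_add_sq hε hf1 hf hR hK))
    _ = 2 * ε + 2 / R ^ 2 * ∫ x, x ^ 2 ∂μ := by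
        rw [integral_add (integrable_const _) (hμ.const_mul _), integral_const_mul (2 / R ^ 2)]
        simp

theorem dBL_le_sum_ramp (hμ : Integrable (fun x => x ^ 2) μ) (hν : Integrable (fun x => x ^ 2) ν)
    (hε : 0 < ε) {K : ℕ} {R : ℝ} (hR : 0 < R) (hK : K * ε = 2 * R) :
    dBL μ ν ≤ 4 * ε + 2 / R ^ 2 * (∫ x, x ^ 2 ∂μ + ∫ x, x ^ 2 ∂ν) +
      ∑ k ∈ Finset.range K,
        |∫ x, ramp (-R + k * ε) ε x ∂μ - ∫ x, ramp (-R + k * ε) ε x ∂ν| := by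
  refine dBL_le fun f hf => ?_
  have hf1 := abs_le_one_of_blNorm_le_one hf
  have hfL := lipschitzWith_one_of_blNorm_le_one hf
  have approx_μ := abs_integral_sub_integral_gridInterp_le hμ hε hf1 hfL hR hK
  have approx_ν := abs_integral_sub_integral_gridInterp_le hν hε hf1 hfL hR hK
  have interp : |∫ x, gridInterp f (-R) ε K x ∂μ - ∫ x, gridInterp f (-R) ε K x ∂ν| ≤
      ∑ k ∈ Finset.range K,
        |∫ x, ramp (-R + k * ε) ε x ∂μ - ∫ x, ramp (-R + k * ε) ε x ∂ν| := by
    rw [integral_gridInterp hε.le, integral_gridInterp hε.le, add_sub_add_left_eq_sub,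
      ← Finset.sum_sub_distrib]
    refine (Finset.abs_sum_le_sum_abs _ _).trans (Finset.sum_le_sum fun k _ => ?_)
    rw [← mul_sub, abs_mul]
    exact mul_le_of_le_one_left (abs_nonneg _) (abs_gridSlope_le hε hfL k)
  rw [abs_le] at approx_μ approx_ν interp ⊢
  constructor <;> linarith

end Interpolation

section LinearStatistics

/-- The constant in the bound for the mean deviation of a linear statistic of a local spin family
with parameter `D`: a concentration term plus the bias. -/
def linStatConst (D : ℕ) : ℝ := Real.pi * Real.exp (1 / 2) + biasConst D

theorem linStatConst_nonneg (D : ℕ) : 0 ≤ linStatConst D :=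
  add_nonneg (by positivity) (biasConst_nonneg D)

/-- The constant in the bound for the mean distance from the spectral measure of a local spin
family with parameter `D` to the Gaussian distribution. -/
def meanDistConst (D : ℕ) : ℝ := 20 + 2 * linStatConst D

theorem rpow_one_sixth_pow_six {x : ℝ} (hx : 0 ≤ x) : (x ^ (1 / 6 : ℝ)) ^ 6 = x := by
  rw [← Real.rpow_natCast, ← Real.rpow_mul hx]
  norm_num

variable {κ ι : Type*} [Fintype κ] [Fintype ι] [DecidableEq ι] {D : ℕ} {b : κ → Matrix ι ι ℂ}

namespace IsLocalSpinFamily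

/-- The bounded-Lipschitz distance from the spectral measure of a local spin family to the Gaussian
distribution, as a function of the coefficients. -/
def distToGaussian (hb : IsLocalSpinFamily D b) (x : κ → ℝ) : ℝ :=
  dBL (spectralMeasure (hb.isHermitian_spinSum x)) (gaussianReal 0 1)

variable [Nonempty ι]

theorem lipschitzWith_distToGaussian (hb : IsLocalSpinFamily D b) :
    LipschitzWith (NNReal.sqrt (Fintype.card κ))⁻¹
      fun x : EuclideanSpace ℝ κ => hb.distToGaussian x.ofLp := by
  refine LipschitzWith.of_dist_le_mul fun x y => ?_
  rw [Real.dist_eq, ← hb.sqrt_hsNormSq_spinSum_sub]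
  exact abs_dBL_spectralMeasure_sub_le _ _

theorem measureReal_distToGaussian_ge_le (hb : IsLocalSpinFamily D b) {t : ℝ} (ht : 0 ≤ t) :
    (stdGaussianPi κ).real
        {x | ∫ y, hb.distToGaussian y ∂stdGaussianPi κ + t ≤ hb.distToGaussian x} ≤
      Real.exp (-(2 / Real.pi ^ 2 * Fintype.card κ * t ^ 2)) := by
  simp only [← le_sub_iff_add_le']
  refine ((hasSubgaussianMGF_stdGaussianPi hb.lipschitzWith_distToGaussian).measure_ge_le
    ht).trans_eq ?_
  simp only [NNReal.coe_pow, NNReal.coe_mul, NNReal.coe_div, NNReal.coe_real_pi, NNReal.coe_inv,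
    Real.coe_sqrt, NNReal.coe_natCast, NNReal.coe_ofNat, mul_pow, inv_pow,
    Real.sq_sqrt (Nat.cast_nonneg _)]
  congr 1
  field

theorem integral_sq_spectralMeasure_spinSum (hb : IsLocalSpinFamily D b) (x : κ → ℝ) :
    ∫ t, t ^ 2 ∂spectralMeasure (hb.isHermitian_spinSum x) =
      (Fintype.card κ : ℝ)⁻¹ * ∑ k, x k ^ 2 := by
  have hA := hb.isHermitian_spinSum x
  rw [integral_spectralMeasure, ← hb.hsNormSq_spinSum, hsNormSq_eq_ntr, hA.eq, ← sq,
    cfc_pow_id (spinSum b x) 2 hA.isSelfAdjoint]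

theorem integral_abs_ntr_cfc_sub_le [Nonempty κ] (hb : IsLocalSpinFamily D b) {s : ℝ → ℝ}
    (hs : ∀ t, |s t| ≤ 1) (hsL : LipschitzWith 1 s) :
    Integrable (fun x => |ntr (cfc s (spinSum b x)) - ∫ t, s t ∂gaussianReal 0 1|)
        (stdGaussianPi κ) ∧
      ∫ x, |ntr (cfc s (spinSum b x)) - ∫ t, s t ∂gaussianReal 0 1| ∂stdGaussianPi κ ≤
        linStatConst D * (√(Fintype.card κ))⁻¹ := by
  have hL := hb.lipschitzWith_ntr_cfc_spinSum hsL
  rw [one_mul] at hL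
  have bias := hb.abs_integral_ntr_cfc_sub_integral_gaussianReal_le hs hsL
  set F := fun x => ntr (cfc s (spinSum b x))
  have int_F := integrable_stdGaussianPi_of_lipschitzWith (F := F) hL
  have concentration := integral_abs_sub_integral_stdGaussianPi_le (F := F) (by simp) hL
  set m := ∫ x, F x ∂stdGaussianPi κ
  set a := ∫ t, s t ∂gaussianReal 0 1
  have int_sub (r : ℝ) : Integrable (fun x => |F x - r|) (stdGaussianPi κ) :=
    (int_F.sub (integrable_const r)).abs
  refine ⟨int_sub a, ?_⟩
  calc ∫ x, |F x - a| ∂stdGaussianPi κ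
      ≤ ∫ x, (|F x - m| + |m - a|) ∂stdGaussianPi κ :=
        integral_mono (int_sub a) ((int_sub m).add (integrable_const _)) fun x => abs_sub_le _ _ _
    _ = ∫ x, |F x - m| ∂stdGaussianPi κ + |m - a| := by
        rw [integral_add (int_sub m) (integrable_const _)]
        simp
    _ ≤ linStatConst D * (√(Fintype.card κ))⁻¹ := by
        rw [linStatConst, add_mul]
        refine add_le_add (concentration.trans_eq ?_) bias
        simp [Real.coe_sqrt]

theorem distToGaussian_le_sum_ramp (hb : IsLocalSpinFamily D b) {ε : ℝ} (hε : 0 < ε) {K : ℕ}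
    {R : ℝ} (hR : 0 < R) (hK : K * ε = 2 * R) (x : κ → ℝ) :
    hb.distToGaussian x ≤
      4 * ε + 2 / R ^ 2 * ((Fintype.card κ : ℝ)⁻¹ * ∑ k, x k ^ 2 + 1) +
        ∑ k ∈ Finset.range K, |ntr (cfc (ramp (-R + k * ε) ε) (spinSum b x)) -
          ∫ t, ramp (-R + k * ε) ε t ∂gaussianReal 0 1| := by
  have hA := hb.isHermitian_spinSum x
  have := isProbabilityMeasure_spectralMeasure hA
  have h := dBL_le_sum_ramp (integrable_spectralMeasure hA _) (integrable_pow_gaussianReal 2)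
    hε hR hK
  simp only [hb.integral_sq_spectralMeasure_spinSum, integral_sq_gaussianReal,
    integral_spectralMeasure] at h
  exact h

variable [Nonempty κ]

theorem integral_distToGaussian_le_of_grid (hb : IsLocalSpinFamily D b) {ε : ℝ} (hε : 0 < ε)
    (hε1 : ε ≤ 1) {K : ℕ} {R : ℝ} (hR : 0 < R) (hK : K * ε = 2 * R) :
    ∫ x, hb.distToGaussian x ∂stdGaussianPi κ ≤
      4 * ε + 4 / R ^ 2 + K * (linStatConst D * (√(Fintype.card κ))⁻¹) := by
  let deviation (k : ℕ) (x : κ → ℝ) : ℝ :=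
    |ntr (cfc (ramp (-R + k * ε) ε) (spinSum b x)) - ∫ t, ramp (-R + k * ε) ε t ∂gaussianReal 0 1|
  have deviation_le (k : ℕ) := hb.integral_abs_ntr_cfc_sub_le (s := ramp (-R + k * ε) ε)
    (fun x => (abs_ramp_le hε.le).trans hε1) lipschitzWith_ramp
  have int_deviations :
      Integrable (fun x => ∑ k ∈ Finset.range K, deviation k x) (stdGaussianPi κ) :=
    integrable_finsetSum _ fun k _ => (deviation_le k).1
  have int_moment :
      Integrable (fun x : κ → ℝ => (Fintype.card κ : ℝ)⁻¹ * ∑ k, x k ^ 2) (stdGaussianPi κ) :=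
    (integrable_finsetSum _ fun k _ => integrable_eval_pow k 2).const_mul _
  have moment : ∫ x : κ → ℝ, (Fintype.card κ : ℝ)⁻¹ * ∑ k, x k ^ 2 ∂stdGaussianPi κ = 1 := by
    rw [integral_const_mul, integral_finsetSum _ fun k _ => integrable_eval_pow k 2]
    simp [integral_eval_sq]
  have int_bound : Integrable (fun x : κ → ℝ => 4 * ε + 2 / R ^ 2 *
      ((Fintype.card κ : ℝ)⁻¹ * ∑ k, x k ^ 2 + 1)) (stdGaussianPi κ) :=
    (integrable_const _).add ((int_moment.add (integrable_const _)).const_mul _)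
  calc ∫ x, hb.distToGaussian x ∂stdGaussianPi κ
      ≤ ∫ x, (4 * ε + 2 / R ^ 2 * ((Fintype.card κ : ℝ)⁻¹ * ∑ k, x k ^ 2 + 1) +
          ∑ k ∈ Finset.range K, deviation k x) ∂stdGaussianPi κ :=
        integral_mono (integrable_stdGaussianPi_of_lipschitzWith hb.lipschitzWith_distToGaussian)
          (int_bound.add int_deviations) (hb.distToGaussian_le_sum_ramp hε hR hK)
    _ = 4 * ε + 2 / R ^ 2 * (1 + 1) +
          ∑ k ∈ Finset.range K, ∫ x, deviation k x ∂stdGaussianPi κ := by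
        rw [integral_add int_bound int_deviations, integral_finsetSum _ fun k _ =>
          (deviation_le k).1, integral_add (integrable_const _)
          ((int_moment.fun_add (integrable_const _)).const_mul _), integral_const_mul (2 / R ^ 2),
          integral_add int_moment (integrable_const _), moment]
        simp [deviation]
    _ ≤ 4 * ε + 2 / R ^ 2 * (1 + 1) + K * (linStatConst D * (√(Fintype.card κ))⁻¹) := by
        gcongr
        refine (Finset.sum_le_sum fun k _ => (deviation_le k).2).trans_eq ?_
        simp
    _ = 4 * ε + 4 / R ^ 2 + K * (linStatConst D * (√(Fintype.card κ))⁻¹) := by ring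

-- The grid has mesh `ε = N ^ (-1 / 6)` and `K ≈ N ^ (1 / 3)` cells, hence `R ≈ N ^ (1 / 6)`, where
-- `N = card κ`; this balances `ε` against `K / √N`, and `1 / R ^ 2` is of lower order.
theorem integral_distToGaussian_le (hb : IsLocalSpinFamily D b) :
    ∫ x, hb.distToGaussian x ∂stdGaussianPi κ ≤
      meanDistConst D / (Fintype.card κ : ℝ) ^ (1 / 6 : ℝ) := by
  set q := (Fintype.card κ : ℝ) ^ (1 / 6 : ℝ)
  have hq1 : 1 ≤ q := Real.one_le_rpow (mod_cast Fintype.card_pos) (by norm_num)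
  have hq0 : 0 < q := by linarith
  set K := ⌈q ^ 2⌉₊
  have le_K : q ^ 2 ≤ K := Nat.le_ceil _
  have K_le : (K : ℝ) ≤ 2 * q ^ 2 := by
    linarith [Nat.ceil_lt_add_one (sq_nonneg q), one_le_pow₀ hq1 (n := 2)]
  have le_R : q / 2 ≤ K * q⁻¹ / 2 := by
    rw [← div_eq_mul_inv]
    gcongr
    rwa [le_div_iff₀ hq0, ← sq]
  have sqrt_card : √(Fintype.card κ) = q ^ 3 := by
    rw [← rpow_one_sixth_pow_six (Nat.cast_nonneg (Fintype.card κ)), Real.sqrt_eq_iff_eq_sq]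
    · ring
    all_goals positivity
  refine (hb.integral_distToGaussian_le_of_grid (K := K) (R := K * q⁻¹ / 2) (inv_pos.2 hq0)
    (inv_le_one_of_one_le₀ hq1) (by linarith) (by ring)).trans ?_
  have := linStatConst_nonneg D
  rw [sqrt_card]
  calc 4 * q⁻¹ + 4 / (K * q⁻¹ / 2) ^ 2 + K * (linStatConst D * (q ^ 3)⁻¹)
      ≤ 4 * q⁻¹ + 4 / (q / 2) ^ 2 + 2 * q ^ 2 * (linStatConst D * (q ^ 3)⁻¹) := by gcongr
    _ = 4 * q⁻¹ + 16 * q⁻¹ * q⁻¹ + 2 * linStatConst D * q⁻¹ := by field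
    _ ≤ 4 * q⁻¹ + 16 * q⁻¹ * 1 + 2 * linStatConst D * q⁻¹ := by
        gcongr
        exact inv_le_one_of_one_le₀ hq1
    _ = meanDistConst D / q := by rw [meanDistConst]; ring

end IsLocalSpinFamily

end LinearStatistics

section Chain

variable {n : ℕ}

instance isProbabilityMeasure_chainMeasure (hn : 2 ≤ n) (x : Fin 3 → Fin 3 → Fin n → ℝ) :
    IsProbabilityMeasure (chainMeasure hn x) :=
  isProbabilityMeasure_spectralMeasure _

/-- The bounded-Lipschitz distance from the empirical spectral measure of the chain to the Gaussian
distribution, as a function of the family of all coefficients. -/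
def chainDist (hn : 2 ≤ n) (x : Fin 3 × Fin 3 × Fin n → ℝ) : ℝ :=
  dBL (chainMeasure hn fun a b j => x (a, b, j)) (gaussianReal 0 1)

theorem chainDist_le_two (hn : 2 ≤ n) (x : Fin 3 × Fin 3 × Fin n → ℝ) : chainDist hn x ≤ 2 :=
  dBL_le_two

theorem continuous_chainDist (hn : 2 ≤ n) : Continuous (chainDist hn) := by
  have continuous_hamiltonian : Continuous fun x : Fin 3 × Fin 3 × Fin n → ℝ =>
      hamiltonian fun a b j => x (a, b, j) := by
    simpa only [hamiltonian_eq_spinSum] using continuous_spinSum _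
  exact continuous_dBL_spectralMeasure continuous_hamiltonian _

theorem chainDist_eq_distToGaussian (hn : 3 ≤ n) :
    chainDist (by lia : 2 ≤ n) = (isLocalSpinFamily_bond hn).distToGaussian := by
  funext x
  simp only [chainDist, chainMeasure, IsLocalSpinFamily.distToGaussian, hamiltonian_eq_spinSum]

theorem integrable_chainDist (hn : 2 ≤ n) :
    Integrable (chainDist hn) (stdGaussianPi (Fin 3 × Fin 3 × Fin n)) := by
  refine .of_bound (continuous_chainDist hn).aestronglyMeasurable 2 (ae_of_all _ fun x => ?_)
  exact (Real.norm_of_nonneg dBL_nonneg).trans_le (chainDist_le_two hn x)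

theorem twenty_le_meanDistConst (D : ℕ) : 20 ≤ meanDistConst D := by
  rw [meanDistConst]
  linarith [linStatConst_nonneg D]

theorem two_lt_meanDistConst_div (D : ℕ) : 2 < meanDistConst D / (2 : ℝ) ^ (1 / 6 : ℝ) := by
  have : (2 : ℝ) ^ (1 / 6 : ℝ) ≤ 2 := Real.rpow_le_self_of_one_le one_le_two (by norm_num)
  rw [lt_div_iff₀ (by positivity)]
  linarith [twenty_le_meanDistConst D]

theorem integral_chainDist_le (hn : 2 ≤ n) :
    ∫ x, chainDist hn x ∂stdGaussianPi (Fin 3 × Fin 3 × Fin n) ≤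
      meanDistConst 27 / (n : ℝ) ^ (1 / 6 : ℝ) := by
  obtain rfl | hn3 := hn.eq_or_lt
  · calc ∫ x, chainDist hn x ∂stdGaussianPi (Fin 3 × Fin 3 × Fin 2)
        ≤ ∫ _, 2 ∂stdGaussianPi (Fin 3 × Fin 3 × Fin 2) :=
          integral_mono (integrable_chainDist hn) (integrable_const _) (chainDist_le_two hn)
      _ ≤ _ := by simpa using (two_lt_meanDistConst_div 27).le
  · have : NeZero n := ⟨by lia⟩
    rw [chainDist_eq_distToGaussian hn3]
    refine (isLocalSpinFamily_bond hn3).integral_distToGaussian_le.trans ?_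
    have := twenty_le_meanDistConst 27
    have : 0 < (n : ℝ) := mod_cast (by lia : 0 < n)
    rw [card_bond_index]
    gcongr
    linarith

theorem measureReal_chainDist_ge_le (hn : 2 ≤ n) {t : ℝ} (ht : 0 ≤ t) :
    (stdGaussianPi (Fin 3 × Fin 3 × Fin n)).real
        {x | meanDistConst 27 / (n : ℝ) ^ (1 / 6 : ℝ) + t ≤ chainDist hn x} ≤
      Real.exp (-(18 / Real.pi ^ 2 * n * t ^ 2)) := by
  obtain rfl | hn3 := hn.eq_or_lt
  · have empty :
        {x | meanDistConst 27 / ((2 : ℕ) : ℝ) ^ (1 / 6 : ℝ) + t ≤ chainDist hn x} = ∅ :=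
      Set.eq_empty_of_forall_notMem fun x hx => by
        have := two_lt_meanDistConst_div 27
        have := chainDist_le_two hn x
        simp only [Set.mem_ofPred_eq, Nat.cast_ofNat] at hx
        linarith
    rw [empty, measureReal_empty]
    positivity
  · have shift_le : {x | meanDistConst 27 / (n : ℝ) ^ (1 / 6 : ℝ) + t ≤ chainDist hn x} ⊆
        {x | ∫ y, chainDist hn y ∂stdGaussianPi _ + t ≤ chainDist hn x} := fun _ hx =>
      (add_le_add_left (integral_chainDist_le hn) t).trans hx
    calc _ ≤ (stdGaussianPi (Fin 3 × Fin 3 × Fin n)).real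
          {x | ∫ y, chainDist hn y ∂stdGaussianPi _ + t ≤ chainDist hn x} :=
          measureReal_mono shift_le
      _ ≤ Real.exp (-(2 / Real.pi ^ 2 * Fintype.card (Fin 3 × Fin 3 × Fin n) * t ^ 2)) := by
          rw [chainDist_eq_distToGaussian hn3]
          exact (isLocalSpinFamily_bond hn3).measureReal_distToGaussian_ge_le ht
      _ = _ := by
          rw [card_bond_index]
          ring_nf

end Chain

section Coupling

variable {Ω : Type u} [MeasurableSpace Ω] {P : Measure Ω}

namespace IsGaussianCoupling

variable {n : ℕ} {Z : Fin 3 → Fin 3 → Fin n → Ω → ℝ}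

theorem hasLaw (h : IsGaussianCoupling P Z) :
    HasLaw (fun ω (k : Fin 3 × Fin 3 × Fin n) => Z k.1 k.2.1 k.2.2 ω) (stdGaussianPi _) P :=
  h.indep.hasLaw_pi fun _ => h.law _ _ _

theorem integrable_dBL (h : IsGaussianCoupling P Z) (hn : 2 ≤ n) :
    Integrable (fun ω => dBL (chainMeasure hn fun a b j => Z a b j ω) (gaussianReal 0 1)) P := by
  have int_map := integrable_chainDist hn
  rw [← h.hasLaw.map_eq] at int_map
  exact int_map.comp_aemeasurable h.hasLaw.aemeasurable

theorem integral_dBL_le (h : IsGaussianCoupling P Z) (hn : 2 ≤ n) :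
    ∫ ω, dBL (chainMeasure hn fun a b j => Z a b j ω) (gaussianReal 0 1) ∂P ≤
      meanDistConst 27 / (n : ℝ) ^ (1 / 6 : ℝ) :=
  (h.hasLaw.integral_comp (continuous_chainDist hn).aestronglyMeasurable).trans_le
    (integral_chainDist_le hn)

theorem measureReal_dBL_ge_le (h : IsGaussianCoupling P Z) (hn : 2 ≤ n) {t : ℝ} (ht : 0 ≤ t) :
    P.real {ω | meanDistConst 27 / (n : ℝ) ^ (1 / 6 : ℝ) + t ≤
        dBL (chainMeasure hn fun a b j => Z a b j ω) (gaussianReal 0 1)} ≤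
      Real.exp (-(18 / Real.pi ^ 2 * n * t ^ 2)) :=
  (h.hasLaw.measureReal_eq
    (measurableSet_le measurable_const (continuous_chainDist hn).measurable)).trans_le
    (measureReal_chainDist_ge_le hn ht)

end IsGaussianCoupling

theorem summable_exp_neg_mul_sq_inv_rpow {c : ℝ} (hc : 0 < c) :
    Summable fun n : ℕ => Real.exp (-(c * n * ((n : ℝ) ^ (1 / 6 : ℝ))⁻¹ ^ 2)) := by
  have exponent (n : ℕ) : (n : ℝ) * ((n : ℝ) ^ (1 / 6 : ℝ))⁻¹ ^ 2 = (n : ℝ) ^ (2 / 3 : ℝ) := by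
    rw [← Real.rpow_neg n.cast_nonneg, ← Real.rpow_natCast, ← Real.rpow_mul n.cast_nonneg,
      ← Real.rpow_one_add' n.cast_nonneg] <;> norm_num
  have decay := (isLittleO_exp_neg_mul_rpow_atTop hc (-3)).comp_tendsto
    ((tendsto_rpow_atTop (by norm_num : (0 : ℝ) < 2 / 3)).comp tendsto_natCast_atTop_atTop)
  refine summable_of_isBigO_nat (Real.summable_nat_rpow.2 (by norm_num : (-2 : ℝ) < -1))
    (decay.isBigO.congr (fun n => ?_) fun n => ?_)
  · simp only [Function.comp_apply, mul_assoc, exponent, neg_mul]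
  · rw [Function.comp_apply, Function.comp_apply, ← Real.rpow_mul n.cast_nonneg]
    norm_num

theorem ae_eventually_dBL_le [IsFiniteMeasure P]
    {Z : (n : ℕ) → Fin 3 → Fin 3 → Fin n → Ω → ℝ}
    (h : ∀ n : ℕ, 2 ≤ n → IsGaussianCoupling P (Z n)) :
    ∀ᵐ ω ∂P, ∃ N : ℕ, ∀ (n : ℕ) (hn : 2 ≤ n), N ≤ n →
      dBL (chainMeasure hn fun a b j => Z n a b j ω) (gaussianReal 0 1) ≤
        (meanDistConst 27 + 1) / (n : ℝ) ^ (1 / 6 : ℝ) := by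
  let far (n : ℕ) : Set Ω := {ω | ∃ hn : 2 ≤ n,
    meanDistConst 27 / (n : ℝ) ^ (1 / 6 : ℝ) + ((n : ℝ) ^ (1 / 6 : ℝ))⁻¹ ≤
      dBL (chainMeasure hn fun a b j => Z n a b j ω) (gaussianReal 0 1)}
  have far_le (n : ℕ) : P (far n) ≤
      .ofReal (Real.exp (-(18 / Real.pi ^ 2 * n * ((n : ℝ) ^ (1 / 6 : ℝ))⁻¹ ^ 2))) := by
    by_cases hn : 2 ≤ n
    · rw [← ofReal_measureReal]
      refine ENNReal.ofReal_le_ofReal ?_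
      simpa only [far, hn, exists_true_left] using (h n hn).measureReal_dBL_ge_le hn
        (t := ((n : ℝ) ^ (1 / 6 : ℝ))⁻¹) (by positivity)
    · simp [far, hn]
  have tsum_far : ∑' n, P (far n) ≠ ∞ :=
    have summable_bound :=
      summable_exp_neg_mul_sq_inv_rpow (by positivity : 0 < 18 / Real.pi ^ 2)
    ne_top_of_le_ne_top summable_bound.tsum_ofReal_ne_top (ENNReal.tsum_le_tsum far_le)
  filter_upwards [ae_eventually_notMem tsum_far] with ω hω
  obtain ⟨N, hN⟩ := eventually_atTop.1 hω
  refine ⟨N, fun n hn hNn => ?_⟩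
  rw [add_div, one_div (_ ^ _)]
  exact (not_le.1 fun hle => hN n hNn ⟨hn, hle⟩).le

end Coupling

end

theorem theorem1 :
    ∃ C C' c : ℝ, 0 < C ∧ 0 < C' ∧ 0 < c ∧
      (∀ (Ω : Type u) [MeasurableSpace Ω] (P : Measure Ω) [IsProbabilityMeasure P]
        (n : ℕ) (hn : 2 ≤ n) (Z : Fin 3 → Fin 3 → Fin n → Ω → ℝ), IsGaussianCoupling P Z →
          (Integrable
              (fun ω => dBL (chainMeasure hn fun a b j => Z a b j ω) (gaussianReal 0 1)) P ∧
            ∫ ω, dBL (chainMeasure hn fun a b j => Z a b j ω) (gaussianReal 0 1) ∂P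
              ≤ C / (n : ℝ) ^ (1 / 6 : ℝ)) ∧
          (∀ t : ℝ, 0 ≤ t →
            P.real {ω | C / (n : ℝ) ^ (1 / 6 : ℝ) + t
                ≤ dBL (chainMeasure hn fun a b j => Z a b j ω) (gaussianReal 0 1)}
              ≤ C * Real.exp (-(c * n * t ^ 2)))) ∧
      (∀ (Ω : Type u) [MeasurableSpace Ω] (P : Measure Ω) [IsProbabilityMeasure P]
        (Z : (n : ℕ) → Fin 3 → Fin 3 → Fin n → Ω → ℝ),
          (∀ n : ℕ, 2 ≤ n → IsGaussianCoupling P (Z n)) →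
          ∀ᵐ ω ∂P, ∃ N : ℕ, ∀ (n : ℕ) (hn : 2 ≤ n), N ≤ n →
            dBL (chainMeasure hn fun a b j => Z n a b j ω) (gaussianReal 0 1)
              ≤ C' / (n : ℝ) ^ (1 / 6 : ℝ)) := by
  have C_ge := twenty_le_meanDistConst 27
  refine ⟨meanDistConst 27, meanDistConst 27 + 1, 18 / Real.pi ^ 2, by linarith, by linarith,
    by positivity, fun Ω _ P _ n hn Z hZ => ?_, fun Ω _ P _ Z hZ => ae_eventually_dBL_le hZ⟩
  refine ⟨⟨hZ.integrable_dBL hn, hZ.integral_dBL_le hn⟩, fun t ht => ?_⟩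
  calc _ ≤ Real.exp (-(18 / Real.pi ^ 2 * n * t ^ 2)) := hZ.measureReal_dBL_ge_le hn ht
    _ ≤ meanDistConst 27 * Real.exp (-(18 / Real.pi ^ 2 * n * t ^ 2)) :=
      le_mul_of_one_le_left (Real.exp_nonneg _) (by linarith)
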